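/- **Setting.** Let $\Bbbk$ be an algebraically closed field, and $\Bbbk^\iota=\Bbbk\setminus\{0\}$. Quivers $P=(P_0,P_1,t,h)$ are finite. Let $Q$ be a quiver, $\Bbbk Q$ its linear path category, $\mathcal I$ an ideal of $\Bbbk Q$ generated by zero relations (paths) and commutativity relations (differences of two parallel paths), and $\Lambda=\Bbbk Q/\mathcal I$. A $\Lambda$-module is a representation of $Q$ that is finite dimensional at each vertex and annihilated by $\mathcal I$. Tensor products and direct sums are taken vertex-wise and arrow-wise; $nM$ is the direct sum of $n$ copies of $M$. A *shape* over $Q$ is a pair $\mathbf F=(F,P)$ with $P$ a quiver and $F:P\to Q$ a morphism of quivers that is injective on the arrows between any two given vertices and strict: distinct arrows of $P$ with the same image have distinct tails and distinct heads. An isomorphism $(F_1,P^1)\to(F_2,P^2)$ is an isomorphism of quivers $\sigma:P^1\to P^2$ with $F_1=F_2\sigma$. The shape is *compatible* with $\mathcal I$ if no path occurring (with non-zero coefficient) in an element of $\mathcal I$ is the image under $F$ of a path of $P$. It is *linear* if $P$ has Dynkin type $\mathbb A_n$ ($n\ge 1$), and *cyclic* if $P$ has extended Dynkin type $\tilde{\mathbb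 A}_n$ ($n\ge 0$, a loop for $n=0$) and the shape has trivial automorphism group. The fibre product $\mathbf F\times\mathbf F'$ of $(F,P)$ and $(F',P')$ is the shape with vertices $\{(x,x')\mid Fx=F'x'\}$, arrows $\{(\alpha,\alpha')\mid F\alpha=F'\alpha'\}$ and the induced map to $Q$. Let $\mathcal L(\mathbf F,\mathbf F')$ be the family of those of its connected components (each with the restricted map to $Q$) that are linear, indexed by the components. The push-down $F_*m$ of a representation $m$ of $P$ has $(F_*m)(x')=\bigoplus_{Fx=x'}m(x)$, and the block of $(F_*m)(\alpha')$ from $m(x)$ to $m(y)$ is $m(\alpha)$ if there is an arrow $\alpha:x\to y$ with $F\alpha=\alpha'$, and $0$ otherwise. For a linear shape $\mathbf F=(F,L)$ the *string* is $S_{\mathbf F}=F_*\chi_L$, where $\chi_L$ is $\Bbbk$ at each vertex and $1_{\Bbbk}$ at each arrow. For a cyclic shape $\mathbf G=(G,Z)$, $\lambda\in\Bbbk^\iota$, $s\ge1$ and $\gamma\in Z_1$, the *band* is $B_{\mathbf G}(\lambda,s,\gamma)=G_*B$, where $B(x)=\Bbbk^s$ for each vertex $x$, $B(\gamma)$ is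 the Jordan block $J_\lambda(s)$, and $B(\alpha)=1$ for the other arrows. **Theorem 4.5.** Let $\mathbf F,\mathbf F'$ be linear shapes and $\mathbf G,\mathbf G'$ cyclic shapes over $Q$, all compatible with $\mathcal I$, let $\gamma$ and $\gamma'$ be arrows of the quivers of $\mathbf G$ and $\mathbf G'$, let $\lambda,\mu\in\Bbbk^\iota$, and let $s,t$ be positive integers. Then strings and bands of these shapes are $\Lambda$-modules, and the following isomorphisms of $\Lambda$-modules hold. 1. $S_{\mathbf F}\otimes S_{\mathbf F'}\cong\bigoplus_{\mathbf H\in\mathcal L(\mathbf F,\mathbf F')}S_{\mathbf H}$. 2. $S_{\mathbf F}\otimes B_{\mathbf G}(\lambda,s,\gamma)\cong\bigoplus_{\mathbf H\in\mathcal L(\mathbf F,\mathbf G)}s\,S_{\mathbf H}$. 3. If $\mathbf G$ and $\mathbf G'$ are not isomorphic, then $B_{\mathbf G}(\lambda,s,\gamma)\otimes B_{\mathbf G'}(\mu,t,\gamma')\cong\bigoplus_{\mathbf H\in\mathcal L(\mathbf G,\mathbf G')}st\,S_{\mathbf H}$. 4. $B_{\mathbf G}(\lambda,s,\gamma)\otimes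 B_{\mathbf G}(\mu,t,\gamma)\cong\bigoplus_{k}B_{\mathbf G}(\lambda\mu,l_k,\gamma)\oplus\bigoplus_{\mathbf H\in\mathcal L(\mathbf G,\mathbf G)}st\,S_{\mathbf H}$, where $(l_k)$ is the non-increasing sequence of positive integers such that $J_\lambda(s)\otimes J_\mu(t)$ is similar to $\bigoplus_kJ_{\lambda\mu}(l_k)$. Such a sequence exists, and for given $s,t$ (and $\Bbbk$) the same sequence serves for all $\lambda,\mu\in\Bbbk^\iota$. -/

import Mathlib

open scoped TensorProduct

universe u u₁ u₂ v w w₁ w₂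

namespace StringCG

/-! ### Finite quivers, morphisms, wrappings, shapes -/

/-- A finite quiver: finite sets of vertices and arrows, with tail and head maps. -/
structure FinQuiver where
  V : Type u
  A : Type u
  t : A → V
  h : A → V
  [finV : Finite V]
  [finA : Finite A]

attribute [instance] FinQuiver.finV FinQuiver.finA

/-- The arrows `x ⟶ y`. This makes Mathlib's paths (`Quiver.Path`) and connected
components (`Quiver.WeaklyConnectedComponent`) available. -/
instance (Q : FinQuiver.{u}) : Quiver Q.V := ⟨fun x y => {a : Q.A // Q.t a = x ∧ Q.h a = y}⟩

/-- The quiver is of Dynkin type `A_{n+1}` for some `n ≥ 0`: its underlying graph is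
`e 0 — e 1 — ⋯ — e n`, with arbitrary orientation of the edges. -/
def FinQuiver.IsLinear (P : FinQuiver.{u}) : Prop :=
  ∃ (n : ℕ) (e : Fin (n + 1) ≃ P.V) (f : Fin n ≃ P.A), ∀ i : Fin n,
    (P.t (f i) = e i.castSucc ∧ P.h (f i) = e i.succ) ∨
    (P.t (f i) = e i.succ ∧ P.h (f i) = e i.castSucc)

/-- The quiver is of extended Dynkin type `Ã_n` for some `n ≥ 0`: its underlying graph is the
cycle with `n + 1` vertices and `n + 1` edges (a loop for `n = 0`, a double edge for `n = 1`),
with arbitrary orientation. The index `i + 1` is taken modulo `n + 1`. -/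
def FinQuiver.IsCyclic (P : FinQuiver.{u}) : Prop :=
  ∃ (n : ℕ) (e : Fin (n + 1) ≃ P.V) (f : Fin (n + 1) ≃ P.A), ∀ i : Fin (n + 1),
    (P.t (f i) = e i ∧ P.h (f i) = e (i + 1)) ∨
    (P.t (f i) = e (i + 1) ∧ P.h (f i) = e i)

/-- A morphism of quivers. -/
structure QHom (P : FinQuiver.{u₁}) (Q : FinQuiver.{u₂}) where
  vert : P.V → Q.V
  arr : P.A → Q.A
  vert_t : ∀ a, vert (P.t a) = Q.t (arr a)
  vert_h : ∀ a, vert (P.h a) = Q.h (arr a)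

/-- The induced Mathlib quiver morphism, used for the action on paths. -/
def QHom.toPrefunctor {P : FinQuiver.{u₁}} {Q : FinQuiver.{u₂}} (F : QHom P Q) : P.V ⥤q Q.V where
  obj := F.vert
  map a := ⟨F.arr a.1, by rw [← F.vert_t, a.2.1], by rw [← F.vert_h, a.2.2]⟩

/-- Wrapping: injective on the arrows between any two given vertices. -/
def QHom.IsWrapping {P : FinQuiver.{u₁}} {Q : FinQuiver.{u₂}} (F : QHom P Q) : Prop :=
  ∀ a b : P.A, P.t a = P.t b → P.h a = P.h b → F.arr a = F.arr b → a = b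

/-- Strictness: distinct arrows with the same image have distinct tails and distinct heads. -/
def QHom.IsStrict {P : FinQuiver.{u₁}} {Q : FinQuiver.{u₂}} (F : QHom P Q) : Prop :=
  ∀ a b : P.A, a ≠ b → F.arr a = F.arr b → P.t a ≠ P.t b ∧ P.h a ≠ P.h b

/-- A shape over `Q`: a quiver with a strict wrapping to `Q`. -/
structure Shape (Q : FinQuiver.{u₂}) where
  P : FinQuiver.{u₁}
  F : QHom P Q
  wrapping : F.IsWrapping
  strict : F.IsStrict

/-- An isomorphism of shapes: an isomorphism of quivers `σ` with `F₁ = F₂ ∘ σ`. -/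
structure ShapeIso {Q : FinQuiver.{u}} (F₁ : Shape.{u₁} Q) (F₂ : Shape.{u₂} Q) where
  vert : F₁.P.V ≃ F₂.P.V
  arr : F₁.P.A ≃ F₂.P.A
  vert_t : ∀ a, vert (F₁.P.t a) = F₂.P.t (arr a)
  vert_h : ∀ a, vert (F₁.P.h a) = F₂.P.h (arr a)
  comp_vert : ∀ x, F₁.F.vert x = F₂.F.vert (vert x)
  comp_arr : ∀ a, F₁.F.arr a = F₂.F.arr (arr a)

/-- A linear shape. -/
def Shape.IsLinear {Q : FinQuiver.{u}} (F : Shape.{u₁} Q) : Prop := F.P.IsLinear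

/-- A cyclic shape: the quiver is cyclic and the shape has trivial automorphism group. -/
def Shape.IsCyclic {Q : FinQuiver.{u}} (G : Shape.{u₁} Q) : Prop :=
  G.P.IsCyclic ∧ ∀ σ : ShapeIso G G, (∀ x, σ.vert x = x) ∧ ∀ a, σ.arr a = a

/-! ### Fibre products and their connected components -/

/-- The fibre product `P¹ × P²` over `Q` of the quivers of two shapes. -/
def fibreQuiver {Q : FinQuiver.{u}} (F₁ : Shape.{u₁} Q) (F₂ : Shape.{u₂} Q) :
    FinQuiver.{max u₁ u₂} where
  V := {x : F₁.P.V × F₂.P.V // F₁.F.vert x.1 = F₂.F.vert x.2}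
  A := {a : F₁.P.A × F₂.P.A // F₁.F.arr a.1 = F₂.F.arr a.2}
  t a := ⟨(F₁.P.t a.1.1, F₂.P.t a.1.2), by
    rw [F₁.F.vert_t, F₂.F.vert_t, a.2]⟩
  h a := ⟨(F₁.P.h a.1.1, F₂.P.h a.1.2), by
    rw [F₁.F.vert_h, F₂.F.vert_h, a.2]⟩

/-- The fibre product of shapes: `P¹ × P²` with the composite `F₁ Π₁ = F₂ Π₂`. -/
def Shape.fibre {Q : FinQuiver.{u}} (F₁ : Shape.{u₁} Q) (F₂ : Shape.{u₂} Q) :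
    Shape.{max u₁ u₂} Q where
  P := fibreQuiver F₁ F₂
  F :=
    { vert := fun x => F₁.F.vert x.1.1
      arr := fun a => F₁.F.arr a.1.1
      vert_t := fun a => F₁.F.vert_t a.1.1
      vert_h := fun a => F₁.F.vert_h a.1.1 }
  wrapping := by
    rintro ⟨⟨a, a'⟩, ha⟩ ⟨⟨b, b'⟩, hb⟩ ht hh hab
    simp only [fibreQuiver, Subtype.mk.injEq, Prod.mk.injEq] at ht hh ha hb hab ⊢
    exact ⟨F₁.wrapping a b ht.1 hh.1 hab,
      F₂.wrapping a' b' ht.2 hh.2 (ha.symm.trans (hab.trans hb))⟩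
  strict := by
    rintro ⟨⟨a, a'⟩, ha⟩ ⟨⟨b, b'⟩, hb⟩ hne hab
    simp only [fibreQuiver, Subtype.mk.injEq, Prod.mk.injEq, ne_eq] at ha hb hab hne ⊢
    by_cases h1 : a = b
    · have h2 : a' ≠ b' := fun h => hne ⟨h1, h⟩
      have := F₂.strict a' b' h2 (ha.symm.trans (hab.trans hb))
      exact ⟨fun h => this.1 h.2, fun h => this.2 h.2⟩
    · have := F₁.strict a b h1 hab
      exact ⟨fun h => this.1 h.1, fun h => this.2 h.1⟩

/-- The set of connected components of a quiver. -/
abbrev FinQuiver.Comp (P : FinQuiver.{u}) : Type u := Quiver.WeaklyConnectedComponent P.V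

instance (P : FinQuiver.{u}) : Finite P.Comp :=
  inferInstanceAs (Finite (Quotient (Quiver.zigzagSetoid P.V)))

/-- The connected component of a vertex. -/
def FinQuiver.comp (P : FinQuiver.{u}) (x : P.V) : P.Comp := Quiver.WeaklyConnectedComponent.mk x

lemma FinQuiver.comp_t_eq_comp_h (P : FinQuiver.{u}) (a : P.A) : P.comp (P.t a) = P.comp (P.h a) :=
  (Quiver.WeaklyConnectedComponent.eq _ _).2
    ⟨Quiver.Hom.toPath (Sum.inl (⟨a, rfl, rfl⟩ : (P.t a) ⟶ (P.h a)))⟩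

/-- The connected component `c` of a quiver, as a quiver. -/
def FinQuiver.compQuiver (P : FinQuiver.{u}) (c : P.Comp) : FinQuiver.{u} where
  V := {x : P.V // P.comp x = c}
  A := {a : P.A // P.comp (P.t a) = c}
  t a := ⟨P.t a.1, a.2⟩
  h a := ⟨P.h a.1, (P.comp_t_eq_comp_h a.1).symm.trans a.2⟩

/-- The restriction of a shape to a connected component of its quiver. -/
def Shape.restrictComp {Q : FinQuiver.{u}} (F : Shape.{u₁} Q) (c : F.P.Comp) :
    Shape.{u₁} Q where
  P := F.P.compQuiver c
  F :=
    { vert := fun x => F.F.vert x.1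
      arr := fun a => F.F.arr a.1
      vert_t := fun a => F.F.vert_t a.1
      vert_h := fun a => F.F.vert_h a.1 }
  wrapping := by
    intro a b ht hh hab
    exact Subtype.ext (F.wrapping a.1 b.1 (congrArg Subtype.val ht) (congrArg Subtype.val hh) hab)
  strict := by
    intro a b hne hab
    have := F.strict a.1 b.1 (fun h => hne (Subtype.ext h)) hab
    exact ⟨fun h => this.1 (congrArg Subtype.val h), fun h => this.2 (congrArg Subtype.val h)⟩

/-- The index set of `𝓛(F, F')`: those connected components of the fibre product that are
linear. Isomorphic shapes at different components are counted separately. -/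
def LinComp {Q : FinQuiver.{u}} (F : Shape.{u₁} Q) (F' : Shape.{u₂} Q) : Type (max u₁ u₂) :=
  {c : (F.fibre F').P.Comp // ((F.fibre F').restrictComp c).IsLinear}

instance {Q : FinQuiver.{u}} (F : Shape.{u₁} Q) (F' : Shape.{u₂} Q) : Finite (LinComp F F') :=
  inferInstanceAs (Finite {c : (F.fibre F').P.Comp // ((F.fibre F').restrictComp c).IsLinear})

/-- The linear shape in `𝓛(F, F')` with a given index. -/
def LinComp.shape {Q : FinQuiver.{u}} {F : Shape.{u₁} Q} {F' : Shape.{u₂} Q} (c : LinComp F F') :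
    Shape.{max u₁ u₂} Q :=
  (F.fibre F').restrictComp c.1

/-! ### Representations -/

/-- A representation of `Q` over `k`, that is, a module over the linear path category `kQ`. -/
structure Rep (k : Type v) [Field k] (Q : FinQuiver.{u}) where
  obj : Q.V → Type w
  [acg : ∀ x, AddCommGroup (obj x)]
  [mod : ∀ x, Module k (obj x)]
  map : ∀ {x y : Q.V}, (x ⟶ y) → (obj x →ₗ[k] obj y)

attribute [instance] Rep.acg Rep.mod

section

variable {k : Type v} [Field k] {Q : FinQuiver.{u}}

/-- Isomorphism of representations: invertible linear maps at the vertices that commute with the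
action of all arrows. -/
def Rep.IsIso (M : Rep.{u, v, w₁} k Q) (N : Rep.{u, v, w₂} k Q) : Prop :=
  ∃ e : ∀ x, M.obj x ≃ₗ[k] N.obj x, ∀ {x y : Q.V} (a : x ⟶ y),
    N.map a ∘ₗ (e x).toLinearMap = (e y).toLinearMap ∘ₗ M.map a

/-- The tensor product, taken vertex-wise and arrow-wise. -/
def Rep.tensor (M : Rep.{u, v, w₁} k Q) (N : Rep.{u, v, w₂} k Q) :
    Rep.{u, v, max w₁ w₂} k Q where
  obj x := M.obj x ⊗[k] N.obj x
  map a := TensorProduct.map (M.map a) (N.map a)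

/-- The direct sum of a finite family of representations, taken vertex-wise and arrow-wise. -/
def Rep.directSum {J : Type w₁} [Finite J] (M : J → Rep.{u, v, w} k Q) :
    Rep.{u, v, max w w₁} k Q where
  obj x := ∀ j, (M j).obj x
  map a := LinearMap.pi fun j => (M j).map a ∘ₗ LinearMap.proj j

/-- The direct sum of two representations. -/
def Rep.prod (M : Rep.{u, v, w₁} k Q) (N : Rep.{u, v, w₂} k Q) :
    Rep.{u, v, max w₁ w₂} k Q where
  obj x := M.obj x × N.obj x
  map a := (M.map a).prodMap (N.map a)

/-- The direct sum `n M` of `n` copies of `M`. -/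
def Rep.copies (n : ℕ) (M : Rep.{u, v, w} k Q) : Rep.{u, v, w} k Q :=
  Rep.directSum fun _ : Fin n => M

/-- The action of a path. -/
def Rep.evalPath (M : Rep.{u, v, w} k Q) {x : Q.V} :
    {y : Q.V} → Quiver.Path x y → (M.obj x →ₗ[k] M.obj y)
  | _, .nil => LinearMap.id
  | _, .cons p a => M.map a ∘ₗ M.evalPath p

/-- The action of a morphism of `kQ`, i.e. of a linear combination of parallel paths. -/
def Rep.eval (M : Rep.{u, v, w} k Q) {x y : Q.V} (r : Quiver.Path x y →₀ k) :
    M.obj x →ₗ[k] M.obj y :=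
  r.sum fun p c => c • M.evalPath p

/-- The representation `χ_Q`: the field at each vertex, the identity at each arrow. -/
def chi (k : Type v) [Field k] (P : FinQuiver.{u}) : Rep.{u, v, v} k P where
  obj _ := k
  map _ := LinearMap.id

open Classical in
/-- The block `A_{yx}` of the push-down at the arrow `a'`: it is `m(a)` if there is an arrow
`a : x ⟶ y` with image `a'` (unique if `F` is a wrapping), and `0` otherwise. -/
noncomputable def pushBlock {P : FinQuiver.{u₁}} (F : QHom P Q) (m : Rep.{u₁, v, w} k P)
    (a' : Q.A) (x y : P.V) : m.obj x →ₗ[k] m.obj y :=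
  if H : ∃ a : x ⟶ y, F.arr a.1 = a' then m.map H.choose else 0

/-- The push-down `F_* m`: at a vertex `x'` it is the direct sum of the `m(x)` with `F x = x'`,
and an arrow acts by the matrix of blocks `pushBlock`. -/
noncomputable def pushdown {P : FinQuiver.{u₁}} (F : QHom P Q) (m : Rep.{u₁, v, w} k P) :
    Rep.{u, v, max u₁ w} k Q where
  obj x' := ∀ x : {x : P.V // F.vert x = x'}, m.obj x.1
  map {x' y'} a' :=
    letI : Fintype {x : P.V // F.vert x = x'} := Fintype.ofFinite _
    { toFun := fun f (y : {y : P.V // F.vert y = y'}) =>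
        ∑ x : {x : P.V // F.vert x = x'}, pushBlock F m a'.1 x.1 y.1 (f x)
      map_add' := fun f g => by
        funext y
        simp [Finset.sum_add_distrib]
      map_smul' := fun c f => by
        funext y
        simp [Finset.smul_sum] }

end

/-! ### Jordan blocks, strings and bands -/

/-- The Jordan block `J_λ(s)` on `k^s`: `λ` on the diagonal, `1` just above it. -/
noncomputable def jordan {k : Type v} [Field k] (lam : k) (s : ℕ) :
    (Fin s → k) →ₗ[k] (Fin s → k) :=
  Matrix.toLin' (Matrix.of fun i j : Fin s =>
    if i = j then lam else if (i : ℕ) + 1 = (j : ℕ) then 1 else 0)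

/-- The non-increasing sequence `l` of positive integers consists of the block sizes of
`J_λ(s) ⊗ J_μ(t)`, that is, `J_λ(s) ⊗ J_μ(t)` is similar to `⨁_i J_{λμ}(l_i)`. -/
def IsJordanDecomp {k : Type v} [Field k] (lam mu : k) (s t : ℕ) {n : ℕ} (l : Fin n → ℕ) : Prop :=
  Antitone l ∧ (∀ i, 0 < l i) ∧
    ∃ e : ((Fin s → k) ⊗[k] (Fin t → k)) ≃ₗ[k] (∀ i : Fin n, Fin (l i) → k),
      (LinearMap.pi fun i => jordan (lam * mu) (l i) ∘ₗ LinearMap.proj i) ∘ₗ e.toLinearMap =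
        e.toLinearMap ∘ₗ TensorProduct.map (jordan lam s) (jordan mu t)

open Classical in
/-- The `kZ`-module `B(λ, s, γ)`: `k^s` at each vertex, `J_λ(s)` at the arrow `γ`, the identity
at the other arrows. -/
noncomputable def bandModule {k : Type v} [Field k] {Z : FinQuiver.{u}} (lam : k) (s : ℕ)
    (γ : Z.A) : Rep.{u, v, v} k Z where
  obj _ := Fin s → k
  map a := if a.1 = γ then jordan lam s else LinearMap.id

/-- The string `S_F = F_* χ` of a (linear) shape. -/
noncomputable def stringRep (k : Type v) [Field k] {Q : FinQuiver.{u}} (F : Shape.{u₁} Q) :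
    Rep.{u, v, max u₁ v} k Q :=
  pushdown F.F (chi k F.P)

/-- The band `B_G(λ, s, γ) = G_* B(λ, s, γ)` of a (cyclic) shape. -/
noncomputable def bandRep {k : Type v} [Field k] {Q : FinQuiver.{u}} (G : Shape.{u₁} Q) (lam : k)
    (s : ℕ) (γ : G.P.A) : Rep.{u, v, max u₁ v} k Q :=
  pushdown G.F (bandModule lam s γ)

/-! ### Ideals of the path category and modules over the factor category -/

/-- An ideal of the linear path category `kQ`: subspaces of the morphism spaces
`kQ(x, y) = (Quiver.Path x y →₀ k)`, closed under composition on both sides with paths (hence,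
by linearity, with all morphisms). -/
structure PathIdeal (k : Type v) [Field k] (Q : FinQuiver.{u}) where
  carrier : ∀ x y : Q.V, Submodule k (Quiver.Path x y →₀ k)
  comp_right : ∀ {x y z : Q.V} (r : Quiver.Path x y →₀ k) (q : Quiver.Path y z),
    r ∈ carrier x y → r.mapDomain (fun p => p.comp q) ∈ carrier x z
  comp_left : ∀ {w x y : Q.V} (q : Quiver.Path w x) (r : Quiver.Path x y →₀ k),
    r ∈ carrier x y → r.mapDomain (fun p => q.comp p) ∈ carrier w y

section

variable {k : Type v} [Field k] {Q : FinQuiver.{u}}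

/-- `I` is the smallest ideal containing the relations `R`. -/
def PathIdeal.IsGeneratedBy (I : PathIdeal k Q)
    (R : ∀ x y : Q.V, Set (Quiver.Path x y →₀ k)) : Prop :=
  (∀ x y, ∀ r ∈ R x y, r ∈ I.carrier x y) ∧
  ∀ J : PathIdeal k Q, (∀ x y, ∀ r ∈ R x y, r ∈ J.carrier x y) →
    ∀ x y, I.carrier x y ≤ J.carrier x y

/-- Semi-monomial: generated by zero relations (paths) and commutativity relations (differences
of two parallel paths). -/
def PathIdeal.IsSemiMonomial (I : PathIdeal k Q) : Prop :=
  ∃ R : ∀ x y : Q.V, Set (Quiver.Path x y →₀ k),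
    (∀ x y, ∀ r ∈ R x y, (∃ p : Quiver.Path x y, r = Finsupp.single p 1) ∨
      ∃ p q : Quiver.Path x y, r = Finsupp.single p 1 - Finsupp.single q 1) ∧
    I.IsGeneratedBy R

/-- The shape is compatible with the ideal: no path that occurs in an element of the ideal
is the image of a path under `F`. -/
def Shape.Compatible (F : Shape.{u₁} Q) (I : PathIdeal k Q) : Prop :=
  ∀ x y : Q.V, ∀ r ∈ I.carrier x y, ∀ p ∈ r.support,
    ∀ (x₀ y₀ : F.P.V) (γ : Quiver.Path x₀ y₀),
      (⟨x, y, p⟩ : Σ x y : Q.V, Quiver.Path x y) ≠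
        ⟨F.F.toPrefunctor.obj x₀, F.F.toPrefunctor.obj y₀, F.F.toPrefunctor.mapPath γ⟩

/-- `M` is an object of `mod kQ/I`: it is finite dimensional at each vertex and annihilated
by `I`. -/
def Rep.IsModule (I : PathIdeal k Q) (M : Rep.{u, v, w} k Q) : Prop :=
  (∀ x, FiniteDimensional k (M.obj x)) ∧ ∀ x y : Q.V, ∀ r ∈ I.carrier x y, M.eval r = 0

/-- `M` and `N` are isomorphic objects of `mod kQ/I`, which is a full subcategory of the
category of representations of `Q`. -/
def IsoMod (I : PathIdeal k Q) (M : Rep.{u, v, w₁} k Q) (N : Rep.{u, v, w₂} k Q) : Prop :=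
  M.IsModule I ∧ N.IsModule I ∧ M.IsIso N

end

end StringCG

open StringCG

/-!
The push-down of a representation along a strict shape is governed by a simple rule: an arrow `a'`
of `Q` sends the component at `t a` to the component at `h a`, for each arrow `a` over `a'`, and
there is at most one such arrow with a given head (`pushdown_map_arr`, `pushdown_map_eq_zero`). This
rule shows that a tensor product of push-downs is the push-down, from the fibre product, of the
tensor product of the pull-backs (`tensor_pushdown`), that a push-down is the direct sum over the
connected components (`pushdown_components`), and that a path acting as non-zero on a push-down lifts
to the shape. By the last fact, representations pushed down from compatible shapes are modules, and
so are their tensor products with anything of finite dimension.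

It remains to analyse the components of the fibre product. Linear and cyclic quivers can be
reoriented so that at most one arrow starts and at most one arrow ends at each vertex. Such
alignments pull back along strict morphisms, hence exist on the components, and a connected aligned
quiver is linear or cyclic. If one factor is linear, the position in it increases along arrows, so no
component is cyclic. If both factors are cyclic, a cyclic component covers both of them. A
rotation of the component that fixes the points of one factor descends to an automorphism of
the other, which is trivial by assumption. So both projections are bijective, and the component is
the graph of an isomorphism of shapes (`exists_shapeIso_of_not_isLinear`). Thus there is no
cyclic component for non-isomorphic shapes, and exactly the diagonal for equal ones.

On a linear component the tensor product is a representation by isomorphisms, which is constant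
(`FinQuiver.IsLinear.exists_trivialization`) and pushes down to copies of a string. On the diagonal
it is `J_λ(s) ⊗ J_μ(t)` at `γ` and the identity elsewhere, and a Jordan decomposition of the
former splits it into bands. The decomposition exists by the structure theorem for modules over
`k[X]`, and scaling a Jordan block by a diagonal matrix reduces all `λ`, `μ` to `1`
(`exists_isJordanDecomp`).
-/

namespace StringCG

/-! ### Isomorphisms of representations -/

section RepIso

variable {k : Type v} [Field k] {Q : FinQuiver.{u}}

/-- An arrow of a finite quiver, as a morphism from its tail to its head. -/
def FinQuiver.hom (Q : FinQuiver.{u}) (a : Q.A) : Q.t a ⟶ Q.h a := ⟨a, rfl, rfl⟩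

lemma Rep.isIso_of_arrows {M : Rep.{u, v, w₁} k Q} {N : Rep.{u, v, w₂} k Q}
    (e : ∀ x, M.obj x ≃ₗ[k] N.obj x)
    (he : ∀ (a : Q.A) v, N.map (Q.hom a) (e _ v) = e _ (M.map (Q.hom a) v)) : M.IsIso N := by
  refine ⟨e, ?_⟩
  rintro _ _ ⟨a, rfl, rfl⟩
  ext v
  exact he a v

lemma Rep.IsIso.symm {M : Rep.{u, v, w₁} k Q} {N : Rep.{u, v, w₂} k Q} (h : M.IsIso N) :
    N.IsIso M := by
  obtain ⟨e, he⟩ := h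
  refine ⟨fun x => (e x).symm, fun {x y} a => ?_⟩
  ext v
  have := LinearMap.congr_fun (he a) ((e x).symm v)
  simp only [LinearMap.comp_apply, LinearEquiv.coe_coe, LinearEquiv.apply_symm_apply] at this ⊢
  rw [this, LinearEquiv.symm_apply_apply]

lemma Rep.IsIso.trans {M : Rep.{u, v, w} k Q} {N : Rep.{u, v, w₁} k Q} {L : Rep.{u, v, w₂} k Q}
    (h : M.IsIso N) (h' : N.IsIso L) : M.IsIso L := by
  obtain ⟨e, he⟩ := h
  obtain ⟨e', he'⟩ := h'
  refine ⟨fun x => (e x).trans (e' x), fun {x y} a => ?_⟩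
  ext v
  have h1 := LinearMap.congr_fun (he a) v
  have h2 := LinearMap.congr_fun (he' a) (e x v)
  simp only [LinearMap.comp_apply, LinearEquiv.coe_coe, LinearEquiv.trans_apply] at h1 h2 ⊢
  rw [h2, h1]

lemma Rep.IsIso.directSum {J : Type w} [Finite J] {M : J → Rep.{u, v, w₁} k Q}
    {N : J → Rep.{u, v, w₂} k Q} (h : ∀ j, (M j).IsIso (N j)) :
    (Rep.directSum M).IsIso (Rep.directSum N) := by
  choose e he using h
  refine ⟨fun x => LinearEquiv.piCongrRight fun j => e j x, fun {x y} a => ?_⟩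
  ext v
  exact funext fun j => LinearMap.congr_fun (he j a) (v j)

lemma Rep.IsIso.prod {M M' : Rep.{u, v, w₁} k Q} {N N' : Rep.{u, v, w₂} k Q} (h : M.IsIso N)
    (h' : M'.IsIso N') : (M.prod M').IsIso (N.prod N') := by
  obtain ⟨e, he⟩ := h
  obtain ⟨e', he'⟩ := h'
  refine ⟨fun x => (e x).prodCongr (e' x), fun {x y} a => LinearMap.ext fun v => ?_⟩
  exact Prod.ext (LinearMap.congr_fun (he a) v.1) (LinearMap.congr_fun (he' a) v.2)

lemma Rep.directSum_reindex {J : Type w} {J' : Type w₁} [Finite J] [Finite J'] (σ : J' ≃ J)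
    (M : J → Rep.{u, v, w₂} k Q) :
    (Rep.directSum M).IsIso (Rep.directSum fun j => M (σ j)) :=
  ⟨fun x => (LinearEquiv.piCongrLeft k (fun j => (M j).obj x) σ).symm, fun _ => rfl⟩

lemma Rep.directSum_unique {J : Type w} [Finite J] [Unique J] (M : J → Rep.{u, v, w₂} k Q) :
    (Rep.directSum M).IsIso (M default) := by
  refine ⟨fun x => ⟨⟨⟨fun f => f default, fun _ _ => rfl⟩, fun _ _ => rfl⟩,
    fun b j => (Unique.eq_default j).symm ▸ b, fun f => ?_, fun b => rfl⟩, fun _ => rfl⟩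
  funext j
  obtain rfl := Unique.eq_default j
  rfl

/-- A direct sum splits along a partition of its index set into two parts. -/
lemma Rep.directSum_split {J : Type w} [Finite J] (p : J → Prop) (M : J → Rep.{u, v, w₂} k Q) :
    (Rep.directSum M).IsIso
      ((Rep.directSum fun j : {j // ¬ p j} => M j).prod
        (Rep.directSum fun j : {j // p j} => M j)) := by
  classical
  refine ⟨fun x => ⟨⟨⟨fun f => (fun j => f j, fun j => f j), fun _ _ => rfl⟩, fun _ _ => rfl⟩,
    fun f j => if h : p j then f.2 ⟨j, h⟩ else f.1 ⟨j, h⟩, fun f => ?_, fun f => ?_⟩, fun _ => rfl⟩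
  · funext j
    by_cases h : p j <;> simp [h]
  · refine Prod.ext (funext fun j => ?_) (funext fun j => ?_)
    · simp [j.2]
    · simp [j.2]

end RepIso

/-! ### Modules over the factor category -/

section Modules

variable {k : Type v} [Field k] {Q : FinQuiver.{u}} {I : PathIdeal k Q}

lemma Rep.IsIso.evalPath {M : Rep.{u, v, w₁} k Q} {N : Rep.{u, v, w₂} k Q}
    {e : ∀ x, M.obj x ≃ₗ[k] N.obj x} (he : ∀ {x y : Q.V} (a : x ⟶ y),
      N.map a ∘ₗ (e x).toLinearMap = (e y).toLinearMap ∘ₗ M.map a)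
    {x y : Q.V} (p : Quiver.Path x y) (v : M.obj x) :
    N.evalPath p (e x v) = e y (M.evalPath p v) := by
  induction p with
  | nil => rfl
  | cons p a ih =>
    have := LinearMap.congr_fun (he a) (M.evalPath p v)
    simp only [LinearMap.comp_apply, LinearEquiv.coe_coe, Rep.evalPath] at this ⊢
    rw [ih, this]

lemma Rep.IsModule.of_isIso {M : Rep.{u, v, w₁} k Q} {N : Rep.{u, v, w₂} k Q}
    (hM : M.IsModule I) (h : M.IsIso N) : N.IsModule I := by
  obtain ⟨e, he⟩ := h
  refine ⟨fun x => ?_, fun x y r hr => ?_⟩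
  · have := hM.1 x
    exact LinearEquiv.finiteDimensional (e x)
  · ext v
    obtain ⟨v, rfl⟩ := (e x).surjective v
    have h := LinearMap.congr_fun (hM.2 x y r hr) v
    simp only [Rep.eval, Finsupp.sum, LinearMap.sum_apply, LinearMap.smul_apply,
      Rep.IsIso.evalPath he, ← map_smul, ← map_sum, LinearMap.zero_apply] at h ⊢
    rw [h, map_zero]

lemma Rep.isoMod_of_isIso {M : Rep.{u, v, w₁} k Q} {N : Rep.{u, v, w₂} k Q}
    (hM : M.IsModule I) (h : M.IsIso N) : IsoMod I M N := ⟨hM, hM.of_isIso h, h⟩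

/-- Every single path that occurs in an element of `I` acts as zero on `M`. Unlike annihilation
by an arbitrary `I`, this property passes to tensor products. -/
def Rep.Kills (I : PathIdeal k Q) (M : Rep.{u, v, w} k Q) : Prop :=
  ∀ x y : Q.V, ∀ r ∈ I.carrier x y, ∀ p ∈ r.support, M.evalPath p = 0

lemma Rep.Kills.isModule {M : Rep.{u, v, w} k Q} (h : M.Kills I)
    (hf : ∀ x, FiniteDimensional k (M.obj x)) : M.IsModule I := by
  refine ⟨hf, fun x y r hr => Finset.sum_eq_zero fun p hp => ?_⟩
  simp [h x y r hr p hp]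

lemma Rep.evalPath_tensor (M : Rep.{u, v, w₁} k Q) (N : Rep.{u, v, w₂} k Q) {x y : Q.V}
    (p : Quiver.Path x y) :
    (M.tensor N).evalPath p = TensorProduct.map (M.evalPath p) (N.evalPath p) := by
  induction p with
  | nil => exact TensorProduct.map_id.symm
  | cons p a ih =>
    simp only [Rep.evalPath]
    rw [ih, TensorProduct.map_comp]
    rfl

lemma Rep.Kills.tensor {M : Rep.{u, v, w₁} k Q} (h : M.Kills I) (N : Rep.{u, v, w₂} k Q) :
    (M.tensor N).Kills I := by
  intro x y r hr p hp
  rw [Rep.evalPath_tensor, h x y r hr p hp, TensorProduct.map_zero_left]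
  rfl

end Modules

/-! ### The push-down of a representation -/

section Pushdown

variable {k : Type v} [Field k] {Q : FinQuiver.{u}}

lemma pushBlock_of_arr (F : Shape.{u₁} Q) (m : Rep.{u₁, v, w} k F.P) (a : F.P.A) {a' : Q.A}
    (ha : F.F.arr a = a') :
    pushBlock F.F m a' (F.P.t a) (F.P.h a) = m.map (F.P.hom a) := by
  have H : ∃ b : F.P.t a ⟶ F.P.h a, F.F.arr b.1 = a' := ⟨F.P.hom a, ha⟩
  have : H.choose = F.P.hom a :=
    Subtype.ext (F.wrapping _ _ H.choose.2.1 H.choose.2.2 (H.choose_spec.trans ha.symm))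
  rw [pushBlock, dif_pos H, this]

/-- As the shape is strict, at most one arrow over `a'` ends in a given vertex, so that only one
block contributes to the corresponding component of the value. -/
lemma pushdown_map_arr (F : Shape.{u₁} Q) (m : Rep.{u₁, v, w} k F.P) (a : F.P.A) {x' y' : Q.V}
    (a' : x' ⟶ y') (ha : F.F.arr a = a'.1) (hx : F.F.vert (F.P.t a) = x')
    (hy : F.F.vert (F.P.h a) = y') (f : (pushdown F.F m).obj x') :
    (pushdown F.F m).map a' f ⟨F.P.h a, hy⟩ = m.map (F.P.hom a) (f ⟨F.P.t a, hx⟩) := by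
  let _ : Fintype {x : F.P.V // F.F.vert x = x'} := Fintype.ofFinite _
  change ∑ x : {x : F.P.V // F.F.vert x = x'}, pushBlock F.F m a'.1 x.1 (F.P.h a) (f x) = _
  rw [Finset.sum_eq_single ⟨F.P.t a, hx⟩]
  · rw [pushBlock_of_arr F m a ha]
  · rintro ⟨x, hx'⟩ - hne
    rw [pushBlock, dif_neg, LinearMap.zero_apply]
    rintro ⟨⟨b, hbt, hb⟩, hb'⟩
    have hba : b = a := by
      by_contra h
      exact (F.strict b a h (hb'.trans ha.symm)).2 hb
    exact hne (Subtype.ext (hba ▸ hbt.symm))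
  · simp

lemma pushdown_map_eq_zero (F : Shape.{u₁} Q) (m : Rep.{u₁, v, w} k F.P) {x' y' : Q.V}
    (a' : x' ⟶ y') (y : {y : F.P.V // F.F.vert y = y'})
    (h : ∀ a : F.P.A, F.F.arr a = a'.1 → F.P.h a ≠ y.1) (f : (pushdown F.F m).obj x') :
    (pushdown F.F m).map a' f y = 0 := by
  let _ : Fintype {x : F.P.V // F.F.vert x = x'} := Fintype.ofFinite _
  change ∑ x : {x : F.P.V // F.F.vert x = x'}, pushBlock F.F m a'.1 x.1 y.1 (f x) = _
  refine Finset.sum_eq_zero fun x _ => ?_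
  rw [pushBlock, dif_neg, LinearMap.zero_apply]
  rintro ⟨b, hb⟩
  exact h _ hb b.2.2

/-- The case distinction behind the two formulas for the action on a push-down. -/
lemma Shape.exists_arr_or (F : Shape.{u₁} Q) (a' : Q.A) (y : F.P.V) :
    (∃ a : F.P.A, F.F.arr a = a' ∧ F.P.h a = y) ∨ ∀ a : F.P.A, F.F.arr a = a' → F.P.h a ≠ y := by
  by_cases h : ∃ a : F.P.A, F.F.arr a = a' ∧ F.P.h a = y
  · exact Or.inl h
  · exact Or.inr fun a h1 h2 => h ⟨a, h1, h2⟩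

lemma sigma_cons_eq {x y z : Q.V} (p : Quiver.Path x y) (a : y ⟶ z) {x' y' z' : Q.V}
    (p' : Quiver.Path x' y') (a' : y' ⟶ z')
    (h : (⟨x, y, p⟩ : Σ x y : Q.V, Quiver.Path x y) = ⟨x', y', p'⟩) (hz : z = z')
    (ha : a.1 = a'.1) :
    (⟨x, z, p.cons a⟩ : Σ x y : Q.V, Quiver.Path x y) = ⟨x', z', p'.cons a'⟩ := by
  cases h
  subst hz
  rw [Subtype.ext ha]

/-- A path which does not act as zero on a push-down is the image of a path. -/
lemma exists_path_of_pushdown_evalPath_ne_zero (F : Shape.{u₁} Q) (m : Rep.{u₁, v, w} k F.P)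
    {x y : Q.V} (p : Quiver.Path x y) (f : (pushdown F.F m).obj x)
    (z : {z : F.P.V // F.F.vert z = y}) (h : (pushdown F.F m).evalPath p f z ≠ 0) :
    ∃ (x₀ : F.P.V) (γ : Quiver.Path x₀ z.1),
      (⟨x, y, p⟩ : Σ x y : Q.V, Quiver.Path x y) =
        ⟨F.F.toPrefunctor.obj x₀, F.F.toPrefunctor.obj z.1, F.F.toPrefunctor.mapPath γ⟩ := by
  induction p with
  | nil =>
    obtain ⟨z, rfl⟩ := z
    exact ⟨z, .nil, rfl⟩
  | @cons y₁ y₂ p a ih =>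
    obtain ⟨z, hz⟩ := z
    rcases F.exists_arr_or a.1 z with ⟨b, hb, rfl⟩ | hb
    · have hx : F.F.vert (F.P.t b) = y₁ := by rw [F.F.vert_t, hb]; exact a.2.1
      rw [Rep.evalPath, LinearMap.comp_apply, pushdown_map_arr F m b a hb hx hz] at h
      obtain ⟨x₀, γ, hγ⟩ := ih ⟨F.P.t b, hx⟩ fun h0 => h (by rw [h0, map_zero])
      exact ⟨x₀, γ.cons (F.P.hom b), sigma_cons_eq _ _ _ _ hγ hz.symm hb.symm⟩
    · exact absurd (pushdown_map_eq_zero F m a ⟨z, hz⟩ hb _) h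

lemma Shape.Compatible.kills_pushdown {I : PathIdeal k Q} {F : Shape.{u₁} Q}
    (hF : F.Compatible I) (m : Rep.{u₁, v, w} k F.P) : (pushdown F.F m).Kills I := by
  intro x y r hr p hp
  ext f
  funext z
  by_contra h
  obtain ⟨x₀, γ, hγ⟩ := exists_path_of_pushdown_evalPath_ne_zero F m p f z h
  exact hF x y r hr p hp x₀ z.1 γ hγ

lemma pushdown_finiteDimensional {P : FinQuiver.{u₁}} (F : QHom P Q) (m : Rep.{u₁, v, w} k P)
    (hm : ∀ x, FiniteDimensional k (m.obj x)) (x : Q.V) :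
    FiniteDimensional k ((pushdown F m).obj x) :=
  inferInstanceAs (FiniteDimensional k (∀ z : {z : P.V // F.vert z = x}, m.obj z.1))

/-- An isomorphism of shapes together with an isomorphism of the representations living on them
induces an isomorphism of push-downs. -/
lemma pushdown_isIso_of_shapeIso {F₁ : Shape.{u₁} Q} {F₂ : Shape.{u₂} Q} (σ : ShapeIso F₁ F₂)
    (m₁ : Rep.{u₁, v, w₁} k F₁.P) (m₂ : Rep.{u₂, v, w₂} k F₂.P)
    (φ : ∀ x, m₁.obj x ≃ₗ[k] m₂.obj (σ.vert x))
    (hφ : ∀ (a : F₁.P.A) v, m₂.map (⟨σ.arr a, (σ.vert_t a).symm, (σ.vert_h a).symm⟩ :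
      σ.vert (F₁.P.t a) ⟶ σ.vert (F₁.P.h a)) (φ _ v) = φ _ (m₁.map (F₁.P.hom a) v)) :
    (pushdown F₁.F m₁).IsIso (pushdown F₂.F m₂) := by
  let ε : ∀ x', {x // F₁.F.vert x = x'} ≃ {x // F₂.F.vert x = x'} := fun x' =>
    σ.vert.subtypeEquiv fun x => by rw [σ.comp_vert]
  let e : ∀ x', (pushdown F₁.F m₁).obj x' ≃ₗ[k] (pushdown F₂.F m₂).obj x' := fun x' =>
    (LinearEquiv.piCongrRight fun x : {x // F₁.F.vert x = x'} => φ x.1).trans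
      (LinearEquiv.piCongrLeft k (fun y : {x // F₂.F.vert x = x'} => m₂.obj y.1) (ε x'))
  have key : ∀ x' f (x : {x // F₁.F.vert x = x'}), e x' f (ε x' x) = φ x.1 (f x) := fun x' f x =>
    Equiv.piCongrLeft_apply_apply (fun y : {x // F₂.F.vert x = x'} => m₂.obj y.1) (ε x')
      (fun x => φ x.1 (f x)) x
  refine Rep.isIso_of_arrows e fun a' f => ?_
  funext y
  obtain ⟨⟨x, hx⟩, rfl⟩ := (ε _).surjective y
  rw [key]
  rcases F₁.exists_arr_or a' x with ⟨a, ha, rfl⟩ | hno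
  · have ht : F₁.F.vert (F₁.P.t a) = Q.t a' := by rw [F₁.F.vert_t, ha]
    rw [pushdown_map_arr F₁ m₁ a (Q.hom a') ha ht hx, ← hφ, ← key _ f ⟨F₁.P.t a, ht⟩]
    have hmap : ∀ (x y : F₂.P.V) (hx : F₂.F.vert x = Q.t a') (hy : F₂.F.vert y = Q.h a')
        (h1 : F₂.P.t (σ.arr a) = x) (h2 : F₂.P.h (σ.arr a) = y)
        (g : (pushdown F₂.F m₂).obj (Q.t a')),
        (pushdown F₂.F m₂).map (Q.hom a') g ⟨y, hy⟩ =
          m₂.map (⟨σ.arr a, h1, h2⟩ : x ⟶ y) (g ⟨x, hx⟩) := by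
      rintro _ _ hx hy rfl rfl g
      exact pushdown_map_arr F₂ m₂ _ _ ((σ.comp_arr a).symm.trans ha) hx hy g
    exact hmap _ _ _ _ (σ.vert_t a).symm (σ.vert_h a).symm _
  · rw [pushdown_map_eq_zero F₁ m₁ (Q.hom a') ⟨x, hx⟩ hno, map_zero]
    refine pushdown_map_eq_zero F₂ m₂ (Q.hom a') _ (fun b hb hb' => ?_) _
    obtain ⟨a, rfl⟩ := σ.arr.surjective b
    refine hno a ((σ.comp_arr a).trans hb) (σ.vert.injective ?_)
    rw [σ.vert_h, hb']
    rfl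

/-- The identity automorphism of a shape. -/
def ShapeIso.refl (F : Shape.{u₁} Q) : ShapeIso F F :=
  ⟨Equiv.refl _, Equiv.refl _, fun _ => rfl, fun _ => rfl, fun _ => rfl, fun _ => rfl⟩

lemma Rep.IsIso.pushdown {F : Shape.{u₁} Q} {m₁ : Rep.{u₁, v, w₁} k F.P}
    {m₂ : Rep.{u₁, v, w₂} k F.P} (h : m₁.IsIso m₂) :
    (StringCG.pushdown F.F m₁).IsIso (StringCG.pushdown F.F m₂) := by
  obtain ⟨φ, hφ⟩ := h
  exact pushdown_isIso_of_shapeIso (ShapeIso.refl F) m₁ m₂ φ fun a v =>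
    LinearMap.congr_fun (hφ (F.P.hom a)) v

lemma pushdown_directSum {J : Type w₁} [Finite J] (F : Shape.{u₁} Q)
    (m : J → Rep.{u₁, v, w} k F.P) :
    (pushdown F.F (Rep.directSum m)).IsIso (Rep.directSum fun j => pushdown F.F (m j)) := by
  refine Rep.isIso_of_arrows (fun x' => ⟨⟨⟨fun f j x => f x j, fun _ _ => rfl⟩, fun _ _ => rfl⟩,
    fun f x j => f j x, fun _ => rfl, fun _ => rfl⟩) fun a' f => ?_
  funext j y
  obtain ⟨y, hy⟩ := y
  rcases F.exists_arr_or a' y with ⟨a, ha, rfl⟩ | hno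
  · have ht : F.F.vert (F.P.t a) = Q.t a' := by rw [F.F.vert_t, ha]
    exact (pushdown_map_arr F (m j) a (Q.hom a') ha ht hy _).trans
      (congrFun (pushdown_map_arr F (Rep.directSum m) a (Q.hom a') ha ht hy f) j).symm
  · exact (pushdown_map_eq_zero F (m j) (Q.hom a') ⟨y, hy⟩ hno _).trans
      (congrFun (pushdown_map_eq_zero F (Rep.directSum m) (Q.hom a') ⟨y, hy⟩ hno f) j).symm

/-- The pull-back of a representation along a morphism of quivers. -/
def Rep.pullback {P : FinQuiver.{u₁}} (π : QHom P Q) (m : Rep.{u, v, w} k Q) :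
    Rep.{u₁, v, w} k P where
  obj x := m.obj (π.vert x)
  map a := m.map (π.toPrefunctor.map a)

/-- The inclusion of a connected component. -/
def FinQuiver.inclComp (P : FinQuiver.{u₁}) (c : P.Comp) : QHom (P.compQuiver c) P where
  vert x := x.1
  arr a := a.1
  vert_t _ := rfl
  vert_h _ := rfl

/-- A push-down is the direct sum of the push-downs of the restrictions to the connected
components. -/
lemma pushdown_components (F : Shape.{u₁} Q) (m : Rep.{u₁, v, w} k F.P) :
    (pushdown F.F m).IsIso (Rep.directSum fun c : F.P.Comp =>
      pushdown (F.restrictComp c).F (m.pullback (F.P.inclComp c))) := by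
  let e : ∀ x', (pushdown F.F m).obj x' ≃ₗ[k] (Rep.directSum fun c : F.P.Comp =>
      pushdown (F.restrictComp c).F (m.pullback (F.P.inclComp c))).obj x' := fun x' =>
    { toFun := fun f c x => f ⟨x.1.1, x.2⟩
      map_add' := fun _ _ => rfl
      map_smul' := fun _ _ => rfl
      invFun := fun g x => g (F.P.comp x.1) ⟨⟨x.1, rfl⟩, x.2⟩
      left_inv := fun _ => rfl
      right_inv := fun g => by
        funext c x
        obtain ⟨⟨x, rfl⟩, hx⟩ := x
        rfl }
  refine Rep.isIso_of_arrows e fun a' f => ?_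
  funext c y
  obtain ⟨⟨y, hyc⟩, hy⟩ := y
  change (pushdown (F.restrictComp c).F (m.pullback (F.P.inclComp c))).map (Q.hom a') (e _ f c)
    ⟨⟨y, hyc⟩, hy⟩ = (pushdown F.F m).map (Q.hom a') f ⟨y, hy⟩
  rcases F.exists_arr_or a' y with ⟨a, ha, rfl⟩ | hno
  · have ht : F.F.vert (F.P.t a) = Q.t a' := by rw [F.F.vert_t, ha]
    have hc : F.P.comp (F.P.t a) = c := (F.P.comp_t_eq_comp_h a).trans hyc
    rw [pushdown_map_arr F m a (Q.hom a') ha ht hy]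
    exact pushdown_map_arr (F.restrictComp c) (m.pullback (F.P.inclComp c)) ⟨a, hc⟩
      (Q.hom a') ha ht hy _
  · rw [pushdown_map_eq_zero F m (Q.hom a') ⟨y, hy⟩ hno]
    refine pushdown_map_eq_zero (F.restrictComp c) (m.pullback (F.P.inclComp c)) (Q.hom a')
      ⟨⟨y, hyc⟩, hy⟩ (fun a ha h => hno a.1 ha (congrArg Subtype.val h)) _

/-- The first projection of a fibre product. -/
def fibreFst (F₁ : Shape.{u₁} Q) (F₂ : Shape.{u₂} Q) : QHom (F₁.fibre F₂).P F₁.P where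
  vert z := z.1.1
  arr a := a.1.1
  vert_t _ := rfl
  vert_h _ := rfl

/-- The second projection of a fibre product. -/
def fibreSnd (F₁ : Shape.{u₁} Q) (F₂ : Shape.{u₂} Q) : QHom (F₁.fibre F₂).P F₂.P where
  vert z := z.1.2
  arr a := a.1.2
  vert_t _ := rfl
  vert_h _ := rfl

/-- Tensor products of dependent functions, indexed by anything equivalent to the pairs of
indices. -/
lemma exists_tensor_pi_equiv {ι : Type w} {κ : Type w₁} {ζ : Type w₂} [Finite ι] [Finite κ]
    (ε : ζ ≃ ι × κ) (A : ι → Type u₁) (B : κ → Type u₂) [∀ i, AddCommGroup (A i)]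
    [∀ i, Module k (A i)] [∀ j, AddCommGroup (B j)] [∀ j, Module k (B j)] :
    ∃ e : ((∀ i, A i) ⊗[k] (∀ j, B j)) ≃ₗ[k] (∀ z : ζ, A (ε z).1 ⊗[k] B (ε z).2),
      ∀ f g z, e (f ⊗ₜ g) z = f (ε z).1 ⊗ₜ g (ε z).2 := by
  classical
  have := Fintype.ofFinite ι
  have := Fintype.ofFinite κ
  let e₁ := TensorProduct.piLeft k (∀ j, B j) A
  let e₂ : (∀ i, A i ⊗[k] (∀ j, B j)) ≃ₗ[k] ∀ i j, A i ⊗[k] B j :=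
    LinearEquiv.piCongrRight fun i => TensorProduct.piRight k k (A i) B
  let e₃ : (∀ i j, A i ⊗[k] B j) ≃ₗ[k] ∀ z : ζ, A (ε z).1 ⊗[k] B (ε z).2 :=
    { toFun := fun f z => f (ε z).1 (ε z).2
      map_add' := fun _ _ => rfl
      map_smul' := fun _ _ => rfl
      invFun := fun g i j => (LinearEquiv.piCongrLeft k (fun p : ι × κ => A p.1 ⊗[k] B p.2) ε) g
        (i, j)
      left_inv := fun f => by
        funext i j
        obtain ⟨z, hz⟩ := ε.surjective (i, j)
        have := Equiv.piCongrLeft_apply_apply (fun p : ι × κ => A p.1 ⊗[k] B p.2) ε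
          (fun z => f (ε z).1 (ε z).2) z
        rw [hz] at this
        exact this
      right_inv := fun g => funext fun z =>
        Equiv.piCongrLeft_apply_apply (fun p : ι × κ => A p.1 ⊗[k] B p.2) ε g z }
  refine ⟨(e₁.trans e₂).trans e₃, fun f g z => ?_⟩
  simp [e₁, e₂, e₃]

/-- The tensor product of two push-downs is a push-down from the fibre product. -/
lemma tensor_pushdown (F₁ : Shape.{u₁} Q) (F₂ : Shape.{u₂} Q) (m₁ : Rep.{u₁, v, w₁} k F₁.P)
    (m₂ : Rep.{u₂, v, w₂} k F₂.P) :
    ((pushdown F₁.F m₁).tensor (pushdown F₂.F m₂)).IsIso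
      (pushdown (F₁.fibre F₂).F
        ((m₁.pullback (fibreFst F₁ F₂)).tensor (m₂.pullback (fibreSnd F₁ F₂)))) := by
  let ε : ∀ x', {z : (F₁.fibre F₂).P.V // (F₁.fibre F₂).F.vert z = x'} ≃
      {x // F₁.F.vert x = x'} × {x // F₂.F.vert x = x'} := fun x' =>
    { toFun := fun z => (⟨z.1.1.1, z.2⟩, ⟨z.1.1.2, z.1.2.symm.trans z.2⟩)
      invFun := fun p => ⟨⟨(p.1.1, p.2.1), p.1.2.trans p.2.2.symm⟩, p.1.2⟩
      left_inv := fun _ => rfl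
      right_inv := fun _ => rfl }
  choose e he using fun x' => exists_tensor_pi_equiv (k := k) (ε x') (fun x => m₁.obj x.1)
    (fun x => m₂.obj x.1)
  refine Rep.isIso_of_arrows e fun a' v => ?_
  induction v using TensorProduct.induction_on with
  | zero => exact (congrArg _ (map_zero _)).trans ((map_zero _).trans
      ((congrArg _ (map_zero _)).trans (map_zero _)).symm)
  | add v₁ v₂ h₁ h₂ => exact (congrArg _ (map_add _ _ _)).trans ((map_add _ _ _).trans
      ((congrArg₂ _ h₁ h₂).trans
        ((congrArg _ (map_add _ _ _)).trans (map_add _ _ _)).symm))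
  | tmul f g =>
    have hR : ((pushdown F₁.F m₁).tensor (pushdown F₂.F m₂)).map (Q.hom a') (f ⊗ₜ g) =
        (pushdown F₁.F m₁).map (Q.hom a') f ⊗ₜ (pushdown F₂.F m₂).map (Q.hom a') g := rfl
    rw [hR]
    funext z
    obtain ⟨⟨⟨y₁, y₂⟩, hy⟩, hz⟩ := z
    have hz₂ : F₂.F.vert y₂ = Q.h a' := hy.symm.trans hz
    refine Eq.trans ?_ (he _ _ _ ⟨⟨(y₁, y₂), hy⟩, hz⟩).symm
    change _ = (pushdown F₁.F m₁).map (Q.hom a') f ⟨y₁, hz⟩ ⊗ₜ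
      (pushdown F₂.F m₂).map (Q.hom a') g ⟨y₂, hz₂⟩
    rcases F₁.exists_arr_or a' y₁ with ⟨a₁, h₁, rfl⟩ | hno
    · rcases F₂.exists_arr_or a' y₂ with ⟨a₂, h₂, rfl⟩ | hno
      · have ht₁ : F₁.F.vert (F₁.P.t a₁) = Q.t a' := by rw [F₁.F.vert_t, h₁]
        have ht₂ : F₂.F.vert (F₂.P.t a₂) = Q.t a' := by rw [F₂.F.vert_t, h₂]
        rw [pushdown_map_arr F₁ m₁ a₁ (Q.hom a') h₁ ht₁ hz,
          pushdown_map_arr F₂ m₂ a₂ (Q.hom a') h₂ ht₂ hz₂]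
        refine (pushdown_map_arr (F₁.fibre F₂) _ ⟨(a₁, a₂), h₁.trans h₂.symm⟩ (Q.hom a') h₁ ht₁ hz
          _).trans ?_
        have := he _ f g ⟨⟨(F₁.P.t a₁, F₂.P.t a₂), ht₁.trans ht₂.symm⟩, ht₁⟩
        exact congrArg (TensorProduct.map (m₁.map (F₁.P.hom a₁)) (m₂.map (F₂.P.hom a₂))) this
      · refine Eq.trans ?_ ((congrArg _ (pushdown_map_eq_zero F₂ m₂ (Q.hom a') ⟨y₂, hz₂⟩ hno
          g)).trans (TensorProduct.tmul_zero _ _)).symm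
        refine pushdown_map_eq_zero (F₁.fibre F₂) _ (Q.hom a') _ (fun b hb hb' => ?_) _
        exact hno b.1.2 (b.2.symm.trans hb) (congrArg (fun z => z.1.2) hb')
    · refine Eq.trans ?_ ((congrArg (· ⊗ₜ _) (pushdown_map_eq_zero F₁ m₁ (Q.hom a') ⟨y₁, hz⟩ hno
        f)).trans (TensorProduct.zero_tmul _ _)).symm
      refine pushdown_map_eq_zero (F₁.fibre F₂) _ (Q.hom a') _ (fun b hb hb' => ?_) _
      exact hno b.1.1 hb (congrArg (fun z => z.1.1) hb')

end Pushdown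

/-! ### Aligned quivers: lines and cycles -/

section Aligned

/-- The start of an arrow, after all arrows `a` with `σ a = false` have been reversed. -/
def FinQuiver.src (P : FinQuiver.{u}) (σ : P.A → Bool) (a : P.A) : P.V :=
  cond (σ a) (P.t a) (P.h a)

/-- The end of an arrow, after all arrows `a` with `σ a = false` have been reversed. -/
def FinQuiver.dst (P : FinQuiver.{u}) (σ : P.A → Bool) (a : P.A) : P.V :=
  cond (σ a) (P.h a) (P.t a)

/-- The signs `σ` reorient the quiver in such a way that each vertex is the start of at most one
arrow and the end of at most one arrow. -/
structure FinQuiver.IsAligned (P : FinQuiver.{u}) (σ : P.A → Bool) : Prop where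
  src_inj : Function.Injective (P.src σ)
  dst_inj : Function.Injective (P.dst σ)

/-- The signs `σ` reorient the quiver to an oriented cycle, and the permutation `τ` moves each
vertex one step along this cycle. -/
structure FinQuiver.IsRotation (P : FinQuiver.{u}) (σ : P.A → Bool) (τ : Equiv.Perm P.V) :
    Prop where
  src_bij : Function.Bijective (P.src σ)
  map_src : ∀ a, τ (P.src σ a) = P.dst σ a
  sameCycle : ∀ x y, τ.SameCycle x y

lemma FinQuiver.src_not (P : FinQuiver.{u}) (σ : P.A → Bool) :
    P.src (fun a => !σ a) = P.dst σ := by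
  funext a
  cases h : σ a <;> simp [FinQuiver.src, FinQuiver.dst, h]

lemma FinQuiver.dst_not (P : FinQuiver.{u}) (σ : P.A → Bool) :
    P.dst (fun a => !σ a) = P.src σ := by
  funext a
  cases h : σ a <;> simp [FinQuiver.src, FinQuiver.dst, h]

lemma FinQuiver.iff_src_dst {P : FinQuiver.{u}} {S : P.V → Prop} (σ : P.A → Bool)
    (h : ∀ a, S (P.src σ a) ↔ S (P.dst σ a)) (a : P.A) : S (P.t a) ↔ S (P.h a) := by
  have := h a
  cases hσ : σ a <;> simp only [FinQuiver.src, FinQuiver.dst, hσ, cond_true, cond_false] at this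
  · exact this.symm
  · exact this

lemma QHom.vert_src {P : FinQuiver.{u₁}} {Z : FinQuiver.{u₂}} (π : QHom P Z) (σ : Z.A → Bool)
    (a : P.A) : π.vert (P.src (fun b => σ (π.arr b)) a) = Z.src σ (π.arr a) := by
  cases h : σ (π.arr a) <;> simp [FinQuiver.src, h, π.vert_t, π.vert_h]

lemma QHom.vert_dst {P : FinQuiver.{u₁}} {Z : FinQuiver.{u₂}} (π : QHom P Z) (σ : Z.A → Bool)
    (a : P.A) : π.vert (P.dst (fun b => σ (π.arr b)) a) = Z.dst σ (π.arr a) := by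
  cases h : σ (π.arr a) <;> simp [FinQuiver.dst, h, π.vert_t, π.vert_h]

/-- Alignments pull back along strict morphisms. -/
lemma FinQuiver.IsAligned.comap {P : FinQuiver.{u₁}} {Z : FinQuiver.{u₂}} {σ : Z.A → Bool}
    (h : Z.IsAligned σ) (π : QHom P Z) (hπ : π.IsStrict) :
    P.IsAligned fun a => σ (π.arr a) := by
  constructor
  · intro a b hab
    have h1 : π.arr a = π.arr b := h.src_inj (by rw [← π.vert_src, ← π.vert_src, hab])
    by_contra hne
    have h2 := hπ a b hne h1
    cases hσ : σ (π.arr a)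
    · have hσ' : σ (π.arr b) = false := by rw [← h1, hσ]
      simp only [FinQuiver.src, hσ, hσ', cond_false] at hab
      exact h2.2 hab
    · have hσ' : σ (π.arr b) = true := by rw [← h1, hσ]
      simp only [FinQuiver.src, hσ, hσ', cond_true] at hab
      exact h2.1 hab
  · intro a b hab
    have h1 : π.arr a = π.arr b := h.dst_inj (by rw [← π.vert_dst, ← π.vert_dst, hab])
    by_contra hne
    have h2 := hπ a b hne h1
    cases hσ : σ (π.arr a)
    · have hσ' : σ (π.arr b) = false := by rw [← h1, hσ]
      simp only [FinQuiver.dst, hσ, hσ', cond_false] at hab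
      exact h2.1 hab
    · have hσ' : σ (π.arr b) = true := by rw [← h1, hσ]
      simp only [FinQuiver.dst, hσ, hσ', cond_true] at hab
      exact h2.2 hab

lemma FinQuiver.IsRotation.isAligned {P : FinQuiver.{u}} {σ : P.A → Bool} {τ : Equiv.Perm P.V}
    (h : P.IsRotation σ τ) : P.IsAligned σ where
  src_inj := h.src_bij.1
  dst_inj a b hab := h.src_bij.1 (τ.injective (by rw [h.map_src, h.map_src, hab]))

lemma FinQuiver.IsRotation.dst_bij {P : FinQuiver.{u}} {σ : P.A → Bool} {τ : Equiv.Perm P.V}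
    (h : P.IsRotation σ τ) : Function.Bijective (P.dst σ) := by
  refine ⟨h.isAligned.dst_inj, fun y => ?_⟩
  obtain ⟨a, ha⟩ := h.src_bij.2 (τ.symm y)
  exact ⟨a, by rw [← h.map_src, ha, Equiv.apply_symm_apply]⟩

/-- The same cycle, run through backwards. -/
lemma FinQuiver.IsRotation.reverse {P : FinQuiver.{u}} {σ : P.A → Bool} {τ : Equiv.Perm P.V}
    (h : P.IsRotation σ τ) : P.IsRotation (fun a => !σ a) τ⁻¹ where
  src_bij := by rw [P.src_not]; exact h.dst_bij
  map_src a := by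
    rw [P.src_not, P.dst_not, ← h.map_src]
    exact τ.symm_apply_apply _
  sameCycle x y := Equiv.Perm.sameCycle_inv.2 (h.sameCycle x y)

/-- A linear quiver is aligned by signs for which the position of a vertex grows along arrows. -/
lemma FinQuiver.IsLinear.exists_aligned {P : FinQuiver.{u}} (h : P.IsLinear) :
    ∃ (σ : P.A → Bool) (pos : P.V → ℕ), P.IsAligned σ ∧
      ∀ a, pos (P.dst σ a) = pos (P.src σ a) + 1 := by
  classical
  obtain ⟨n, e, f, hf⟩ := h
  let σ : P.A → Bool := fun a => decide (P.t a = e (f.symm a).castSucc)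
  have hne : ∀ i : Fin n, e i.succ ≠ e i.castSucc := fun i hi => by
    have := congrArg Fin.val (e.injective hi)
    simp at this
  have hs : ∀ i, P.src σ (f i) = e i.castSucc ∧ P.dst σ (f i) = e i.succ := fun i => by
    rcases hf i with ⟨h1, h2⟩ | ⟨h1, h2⟩
    · simp [FinQuiver.src, FinQuiver.dst, σ, h1, h2]
    · simp [FinQuiver.src, FinQuiver.dst, σ, h1, h2, hne]
  refine ⟨σ, fun x => e.symm x, ⟨fun a b hab => ?_, fun a b hab => ?_⟩, fun a => ?_⟩
  · obtain ⟨i, rfl⟩ := f.surjective a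
    obtain ⟨j, rfl⟩ := f.surjective b
    rw [(hs i).1, (hs j).1] at hab
    rw [Fin.castSucc_injective n (e.injective hab)]
  · obtain ⟨i, rfl⟩ := f.surjective a
    obtain ⟨j, rfl⟩ := f.surjective b
    rw [(hs i).2, (hs j).2] at hab
    rw [Fin.succ_injective n (e.injective hab)]
  · obtain ⟨i, rfl⟩ := f.surjective a
    simp [(hs i).1, (hs i).2]

lemma FinQuiver.IsCyclic.exists_rotation {P : FinQuiver.{u}} (h : P.IsCyclic) :
    ∃ (σ : P.A → Bool) (τ : Equiv.Perm P.V), P.IsRotation σ τ := by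
  classical
  obtain ⟨n, e, f, hf⟩ := h
  let σ : P.A → Bool := fun a =>
    decide (P.t a = e (f.symm a) ∧ P.h a = e (f.symm a + 1))
  let τ : Equiv.Perm P.V := (e.symm.trans (Equiv.addRight 1)).trans e
  have hτ : ∀ i, τ (e i) = e (i + 1) := fun i => by simp [τ]
  have hs : ∀ i, P.src σ (f i) = e i ∧ P.dst σ (f i) = e (i + 1) := fun i => by
    by_cases h : P.t (f i) = e i ∧ P.h (f i) = e (i + 1)
    · simp [FinQuiver.src, FinQuiver.dst, σ, h]
    · have h' := (hf i).resolve_left h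
      have hσ : σ (f i) = false := by simpa [σ] using h
      simp [FinQuiver.src, FinQuiver.dst, hσ, h']
  have hsrc : P.src σ = e ∘ f.symm := funext fun a => by
    obtain ⟨i, rfl⟩ := f.surjective a
    simp [(hs i).1]
  refine ⟨σ, τ, by rw [hsrc]; exact e.bijective.comp f.symm.bijective, fun a => ?_, fun x y => ?_⟩
  · obtain ⟨i, rfl⟩ := f.surjective a
    rw [(hs i).1, (hs i).2, hτ]
  · obtain ⟨i, rfl⟩ := e.surjective x
    obtain ⟨j, rfl⟩ := e.surjective y
    have h0 : ∀ i, τ.SameCycle (e 0) (e i) := fun i => by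
      induction i using Fin.induction with
      | zero => exact Equiv.Perm.SameCycle.refl _ _
      | succ i ih => rwa [← Fin.coeSucc_eq_succ, ← hτ, Equiv.Perm.sameCycle_apply_right]
    exact (h0 i).symm.trans (h0 j)

/-- A quiver is connected if each set of vertices that contains, with one end of an arrow, also the
other end, is empty or consists of all vertices. -/
def FinQuiver.IsConnected (P : FinQuiver.{u}) : Prop :=
  ∀ S : P.V → Prop, (∀ a, S (P.t a) ↔ S (P.h a)) → ∀ x y, S x → S y

lemma FinQuiver.of_comp_eq {P : FinQuiver.{u}} {S : P.V → Prop} (hS : ∀ a, S (P.t a) ↔ S (P.h a))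
    {x y : P.V} (h : P.comp x = P.comp y) (hx : S x) : S y := by
  obtain ⟨p⟩ := (Quiver.WeaklyConnectedComponent.eq x y).1 h
  have key : ∀ (z : Quiver.Symmetrify P.V) (_ : @Quiver.Path (Quiver.Symmetrify P.V) _ x z),
      S z := fun z p => by
    induction p with
    | nil => exact hx
    | @cons b c p a ih =>
      rcases a with ⟨a, ht, hh⟩ | ⟨a, ht, hh⟩
      · have := (hS a).1 (by rw [ht]; exact ih)
        rw [hh] at this
        exact this
      · have := (hS a).2 (by rw [hh]; exact ih)
        rw [ht] at this
        exact this
  exact key y p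

lemma FinQuiver.compQuiver_isConnected (P : FinQuiver.{u}) (c : P.Comp) :
    (P.compQuiver c).IsConnected := by
  intro S hS x y hx
  have h := FinQuiver.of_comp_eq (P := P) (S := fun z => ∃ hz : P.comp z = c, S ⟨z, hz⟩)
    (fun a => ⟨fun ⟨h, hs⟩ => ⟨(P.comp_t_eq_comp_h a).symm.trans h, (hS ⟨a, h⟩).1 hs⟩,
      fun ⟨h, hs⟩ => ⟨(P.comp_t_eq_comp_h a).trans h,
        (hS ⟨a, (P.comp_t_eq_comp_h a).trans h⟩).2 hs⟩⟩)
    (x.2.trans y.2.symm) ⟨x.2, hx⟩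
  exact h.2

lemma FinQuiver.IsLinear.card {P : FinQuiver.{u}} (h : P.IsLinear) :
    Nat.card P.V = Nat.card P.A + 1 := by
  obtain ⟨n, e, f, -⟩ := h
  rw [Nat.card_congr e.symm, Nat.card_congr f.symm]
  simp

/-- Walking forward from a vertex that is not the end of an arrow exhausts a connected aligned
quiver, which is therefore linear. -/
lemma FinQuiver.IsAligned.isLinear {P : FinQuiver.{u}} {σ : P.A → Bool} (h : P.IsAligned σ)
    (hc : P.IsConnected) (x₀ : P.V) (hx₀ : ∀ a, P.dst σ a ≠ x₀) : P.IsLinear := by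
  classical
  let T : P.V → P.V := fun x => if hx : ∃ a, P.src σ a = x then P.dst σ hx.choose else x
  have hT : ∀ a, T (P.src σ a) = P.dst σ a := fun a => by
    have hx : ∃ b, P.src σ b = P.src σ a := ⟨a, rfl⟩
    simp only [T]
    rw [dif_pos hx, h.src_inj hx.choose_spec]
  let X : ℕ → P.V := fun i => T^[i] x₀
  have hX : ∀ i, X (i + 1) = T (X i) := fun i => Function.iterate_succ_apply' T i x₀
  -- As long as the walk can be continued, it does not return to an earlier vertex.
  have hinj : ∀ j, (∀ l < j, ∃ a, P.src σ a = X l) → ∀ i < j, X i ≠ X j := by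
    intro j
    induction j with
    | zero => intro _ i hi; omega
    | succ j ih =>
      intro hj i hi hij
      obtain ⟨a, ha⟩ := hj j (by omega)
      rw [hX, ← ha, hT] at hij
      rcases i with _ | i
      · exact hx₀ a hij.symm
      · obtain ⟨b, hb⟩ := hj i (by omega)
        rw [hX, ← hb, hT] at hij
        have hba := h.dst_inj hij
        refine ih (fun l hl => hj l (by omega)) i (by omega) ?_
        rw [← ha, ← hb, hba]
  have hfin : ∃ n, ¬ ∃ a, P.src σ a = X n := by
    by_contra hno
    push Not at hno
    refine not_injective_infinite_finite X fun i j hij => ?_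
    by_contra hne
    rcases Nat.lt_or_gt_of_ne hne with h' | h'
    · exact hinj j (fun l _ => hno l) i h' hij
    · exact hinj i (fun l _ => hno l) j h' hij.symm
  let n := Nat.find hfin
  have hn : ¬ ∃ a, P.src σ a = X n := Nat.find_spec hfin
  have hlt : ∀ i < n, ∃ a, P.src σ a = X i := fun i hi => not_not.1 (Nat.find_min hfin hi)
  choose A hA using hlt
  have hA' : ∀ i (hi : i < n), P.dst σ (A i hi) = X (i + 1) := fun i hi => by
    rw [hX, ← hA i hi, hT]
  have hall : ∀ x, ∃ i ≤ n, X i = x := by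
    refine fun x => hc (fun x => ∃ i ≤ n, X i = x) (FinQuiver.iff_src_dst
      (S := fun x => ∃ i ≤ n, X i = x) σ fun a => ?_) x₀ x
      ⟨0, Nat.zero_le _, rfl⟩
    constructor
    · rintro ⟨i, hi, hia⟩
      have hin : i ≠ n := fun h' => hn ⟨a, by rw [← h', hia]⟩
      exact ⟨i + 1, by omega, by rw [hX, hia, hT]⟩
    · rintro ⟨i, hi, hia⟩
      rcases i with _ | i
      · exact absurd hia.symm (hx₀ a)
      · have := h.dst_inj ((hA' i (by omega)).trans hia)
        exact ⟨i, by omega, by rw [← hA i (by omega), this]⟩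
  have hXinj : ∀ i ≤ n, ∀ j ≤ n, X i = X j → i = j := fun i hi j hj hij => by
    by_contra hne
    rcases Nat.lt_or_gt_of_ne hne with h' | h'
    · exact hinj j (fun l hl => ⟨A l (by omega), hA l (by omega)⟩) i h' hij
    · exact hinj i (fun l hl => ⟨A l (by omega), hA l (by omega)⟩) j h' hij.symm
  let e : Fin (n + 1) ≃ P.V := Equiv.ofBijective (fun i => X i)
    ⟨fun i j hij => Fin.ext (hXinj i (by omega) j (by omega) hij), fun x => by
      obtain ⟨i, hi, rfl⟩ := hall x
      exact ⟨⟨i, by omega⟩, rfl⟩⟩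
  let f : Fin n ≃ P.A := Equiv.ofBijective (fun i => A i i.2)
    ⟨fun i j hij => Fin.ext (hXinj i (by omega) j (by omega) (by
        rw [← hA i i.2, ← hA j j.2]
        exact congrArg _ hij)),
      fun a => by
        obtain ⟨i, hi, hia⟩ := hall (P.src σ a)
        have hin : i ≠ n := fun h' => hn ⟨a, by rw [← h', hia]⟩
        exact ⟨⟨i, by omega⟩, h.src_inj ((hA i (by omega)).trans hia)⟩⟩
  refine ⟨n, e, f, fun i => ?_⟩
  have h1 : P.src σ (f i) = e i.castSucc := hA i i.2
  have h2 : P.dst σ (f i) = e i.succ := hA' i i.2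
  rw [← h1, ← h2]
  cases hσ : σ (f i) <;> simp [FinQuiver.src, FinQuiver.dst, hσ]

/-- A connected aligned quiver that is not linear is a cycle. -/
lemma FinQuiver.IsAligned.exists_rotation {P : FinQuiver.{u}} {σ : P.A → Bool}
    (h : P.IsAligned σ) (hc : P.IsConnected) (hl : ¬ P.IsLinear) :
    ∃ τ : Equiv.Perm P.V, P.IsRotation σ τ := by
  have hd : Function.Bijective (P.dst σ) := by
    refine ⟨h.dst_inj, fun x => ?_⟩
    by_contra hx
    exact hl (h.isLinear hc x fun a ha => hx ⟨a, ha⟩)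
  have hs : Function.Bijective (P.src σ) :=
    (Nat.bijective_iff_injective_and_card _).2
      ⟨h.src_inj, Nat.card_congr (Equiv.ofBijective _ hd)⟩
  let τ : Equiv.Perm P.V := (Equiv.ofBijective _ hs).symm.trans (Equiv.ofBijective _ hd)
  have hτ : ∀ a, τ (P.src σ a) = P.dst σ a := fun a => by
    have : (Equiv.ofBijective _ hs).symm (P.src σ a) = a :=
      (Equiv.ofBijective _ hs).symm_apply_apply a
    simp [τ, this]
  refine ⟨τ, hs, hτ, fun x y => ?_⟩
  refine hc (fun y => τ.SameCycle x y) (FinQuiver.iff_src_dst σ fun a => ?_) x y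
    (Equiv.Perm.SameCycle.refl _ _)
  rw [← hτ, Equiv.Perm.sameCycle_apply_right]

end Aligned

/-! ### Components of fibre products -/

section Components

variable {Q : FinQuiver.{u}}

/-- The first projection of a component of a fibre product. -/
def compFst (F₁ : Shape.{u₁} Q) (F₂ : Shape.{u₂} Q) (c : (F₁.fibre F₂).P.Comp) :
    QHom ((F₁.fibre F₂).P.compQuiver c) F₁.P where
  vert z := z.1.1.1
  arr a := a.1.1.1
  vert_t _ := rfl
  vert_h _ := rfl

/-- The second projection of a component of a fibre product. -/
def compSnd (F₁ : Shape.{u₁} Q) (F₂ : Shape.{u₂} Q) (c : (F₁.fibre F₂).P.Comp) :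
    QHom ((F₁.fibre F₂).P.compQuiver c) F₂.P where
  vert z := z.1.1.2
  arr a := a.1.1.2
  vert_t _ := rfl
  vert_h _ := rfl

lemma compFst_isStrict (F₁ : Shape.{u₁} Q) (F₂ : Shape.{u₂} Q) (c : (F₁.fibre F₂).P.Comp) :
    (compFst F₁ F₂ c).IsStrict := by
  rintro ⟨⟨⟨a, a'⟩, ha⟩, hac⟩ ⟨⟨⟨b, b'⟩, hb⟩, hbc⟩ hne hab
  change a = b at hab
  subst hab
  have hne' : a' ≠ b' := fun h => hne (by subst h; rfl)
  have := F₂.strict a' b' hne' (ha.symm.trans hb)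
  exact ⟨fun h => this.1 (congrArg (fun z => z.1.1.2) h),
    fun h => this.2 (congrArg (fun z => z.1.1.2) h)⟩

lemma compSnd_isStrict (F₁ : Shape.{u₁} Q) (F₂ : Shape.{u₂} Q) (c : (F₁.fibre F₂).P.Comp) :
    (compSnd F₁ F₂ c).IsStrict := by
  rintro ⟨⟨⟨a, a'⟩, ha⟩, hac⟩ ⟨⟨⟨b, b'⟩, hb⟩, hbc⟩ hne hab
  change a' = b' at hab
  subst hab
  have hne' : a ≠ b := fun h => hne (by subst h; rfl)
  have := F₁.strict a b hne' (ha.trans hb.symm)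
  exact ⟨fun h => this.1 (congrArg (fun z => z.1.1.1) h),
    fun h => this.2 (congrArg (fun z => z.1.1.1) h)⟩

lemma FinQuiver.exists_comp_eq (P : FinQuiver.{u}) (c : P.Comp) : ∃ x, P.comp x = c :=
  Quotient.exists_rep c

/-- A component of a fibre product with a linear shape contains a vertex of lowest position, at
which no arrow ends. -/
lemma restrictComp_fibre_isLinear {F₁ : Shape.{u₁} Q} (h : F₁.IsLinear) (F₂ : Shape.{u₂} Q)
    (c : (F₁.fibre F₂).P.Comp) : ((F₁.fibre F₂).restrictComp c).IsLinear := by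
  obtain ⟨σ, pos, hσ, hpos⟩ := h.exists_aligned
  obtain ⟨x, hx⟩ := FinQuiver.exists_comp_eq _ c
  have : Nonempty ((F₁.fibre F₂).P.compQuiver c).V := ⟨⟨x, hx⟩⟩
  obtain ⟨x₀, hx₀⟩ := Finite.exists_min fun z => pos ((compFst F₁ F₂ c).vert z)
  refine (hσ.comap _ (compFst_isStrict F₁ F₂ c)).isLinear
    (FinQuiver.compQuiver_isConnected _ c) x₀ fun a ha => ?_
  have h1 := hx₀ (FinQuiver.src _ (fun b => σ ((compFst F₁ F₂ c).arr b)) a)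
  rw [← ha, QHom.vert_src, QHom.vert_dst, hpos] at h1
  omega

end Components

/-! ### Cyclic components -/

section Cyclic

variable {Q : FinQuiver.{u}}

/-- A bijection of the vertices of two cyclic shapes that commutes with the rotations and lifts to
the arrows is an isomorphism of shapes. -/
lemma exists_shapeIso {G : Shape.{u₁} Q} {G' : Shape.{u₂} Q} {σ : G.P.A → Bool}
    {σ' : G'.P.A → Bool} {τ : Equiv.Perm G.P.V} {τ' : Equiv.Perm G'.P.V}
    (h : G.P.IsRotation σ τ) (h' : G'.P.IsRotation σ' τ') (φ : G.P.V ≃ G'.P.V)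
    (hφ : ∀ x, φ (τ x) = τ' (φ x))
    (harr : ∀ a, ∃ a', G'.P.src σ' a' = φ (G.P.src σ a) ∧ σ' a' = σ a ∧
      G'.F.arr a' = G.F.arr a) :
    ∃ ρ : ShapeIso G G', ∀ x, ρ.vert x = φ x := by
  choose f hf hfσ hfF using harr
  have hfd : ∀ a, G'.P.dst σ' (f a) = φ (G.P.dst σ a) := fun a => by
    rw [← h'.map_src, hf, ← hφ, h.map_src]
  have hfb : Function.Bijective f := by
    refine ⟨fun a b hab => h.src_bij.1 (φ.injective ?_), fun b => ?_⟩
    · rw [← hf, ← hf, hab]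
    · obtain ⟨a, ha⟩ := h.src_bij.2 (φ.symm (G'.P.src σ' b))
      exact ⟨a, h'.src_bij.1 (by rw [hf, ha, Equiv.apply_symm_apply])⟩
  refine ⟨⟨φ, Equiv.ofBijective f hfb, fun a => ?_, fun a => ?_, fun x => ?_, fun a => ?_⟩,
    fun x => rfl⟩
  · have h1 := hf a
    have h2 := hfd a
    cases hσ : σ a
    · simpa [FinQuiver.dst, hfσ, hσ] using h2.symm
    · simpa [FinQuiver.src, hfσ, hσ] using h1.symm
  · have h1 := hf a
    have h2 := hfd a
    cases hσ : σ a
    · simpa [FinQuiver.src, hfσ, hσ] using h1.symm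
    · simpa [FinQuiver.dst, hfσ, hσ] using h2.symm
  · obtain ⟨a, rfl⟩ := h.src_bij.2 x
    rw [← hf]
    cases hσ : σ a
    · simp [FinQuiver.src, hfσ, hσ, G.F.vert_h, G'.F.vert_h, hfF]
    · simp [FinQuiver.src, hfσ, hσ, G.F.vert_t, G'.F.vert_t, hfF]
  · exact (hfF a).symm

lemma FinQuiver.IsRotation.vert_apply {C : FinQuiver.{u₁}} {Z : FinQuiver.{u₂}} {π : QHom C Z}
    {σ : Z.A → Bool} {τ : Equiv.Perm Z.V} {T : Equiv.Perm C.V}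
    (hC : C.IsRotation (fun a => σ (π.arr a)) T) (h : Z.IsRotation σ τ) (c : C.V) :
    π.vert (T c) = τ (π.vert c) := by
  obtain ⟨b, rfl⟩ := hC.src_bij.2 c
  rw [hC.map_src, π.vert_dst, π.vert_src, h.map_src]

lemma FinQuiver.IsRotation.vert_zpow_apply {C : FinQuiver.{u₁}} {Z : FinQuiver.{u₂}}
    {π : QHom C Z} {σ : Z.A → Bool} {τ : Equiv.Perm Z.V} {T : Equiv.Perm C.V}
    (hC : C.IsRotation (fun a => σ (π.arr a)) T) (h : Z.IsRotation σ τ) (i : ℤ) (c : C.V) :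
    π.vert ((T ^ i) c) = (τ ^ i) (π.vert c) := by
  induction i using Int.induction_on with
  | zero => simp
  | succ i ih =>
    rw [add_comm, zpow_add, zpow_add, Equiv.Perm.mul_apply, Equiv.Perm.mul_apply, zpow_one,
      zpow_one, hC.vert_apply h, ih]
  | pred i ih =>
    rw [sub_eq_neg_add, zpow_add, zpow_add, Equiv.Perm.mul_apply, Equiv.Perm.mul_apply,
      zpow_neg_one, zpow_neg_one, ← ih, Equiv.Perm.eq_inv_iff_eq, ← hC.vert_apply h]
    exact congrArg _ (T.apply_symm_apply _)

lemma FinQuiver.IsRotation.zpow_eq_one {P : FinQuiver.{u}} {σ : P.A → Bool}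
    {τ : Equiv.Perm P.V} (h : P.IsRotation σ τ) {i : ℤ} {x : P.V} (hx : (τ ^ i) x = x) :
    τ ^ i = 1 := by
  ext y
  obtain ⟨j, rfl⟩ := h.sameCycle x y
  rw [← Equiv.Perm.mul_apply, ← zpow_add, add_comm, zpow_add, Equiv.Perm.mul_apply, hx,
    Equiv.Perm.one_apply]

/-- A cycle `C` that covers two cycles over `Q`, the second of which has no automorphisms over `Q`.
A rotation of `C` that fixes the points of the first cycle descends to an automorphism of
the second, hence fixes its points, too. Therefore the first projection is injective. -/
lemma fst_injective_of_rotation {G : Shape.{u₁} Q} {G' : Shape.{u₂} Q} {C : FinQuiver.{w}}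
    {π : QHom C G.P} {π' : QHom C G'.P} (hπ : ∀ a, G.F.arr (π.arr a) = G'.F.arr (π'.arr a))
    (hinj : ∀ c d, π.vert c = π.vert d → π'.vert c = π'.vert d → c = d)
    {σ : G.P.A → Bool} {σ' : G'.P.A → Bool} {τ : Equiv.Perm G.P.V} {τ' : Equiv.Perm G'.P.V}
    {T : Equiv.Perm C.V} (h : G.P.IsRotation σ τ) (h' : G'.P.IsRotation σ' τ')
    (hC : C.IsRotation (fun a => σ (π.arr a)) T) (hC' : C.IsRotation (fun a => σ' (π'.arr a)) T)
    (hσ : ∀ a, σ (π.arr a) = σ' (π'.arr a))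
    (haut : ∀ ρ : ShapeIso G' G', ∀ x, ρ.vert x = x) (c d : C.V) (hcd : π.vert c = π.vert d) :
    c = d := by
  obtain ⟨i, rfl⟩ := hC.sameCycle c d
  rw [hC.vert_zpow_apply h] at hcd
  have hτ := h.zpow_eq_one hcd.symm
  obtain ⟨ρ, hρ⟩ := exists_shapeIso h' h' (τ' ^ i)
    (fun x => by rw [← Equiv.Perm.mul_apply, ← Equiv.Perm.mul_apply, ← zpow_add_one,
      ← zpow_one_add, add_comm]) (fun a => by
      obtain ⟨j, hj⟩ := h'.sameCycle (π'.vert c) (G'.P.src σ' a)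
      obtain ⟨b, hb⟩ := hC'.src_bij.2 ((T ^ j) c)
      have hba : π'.arr b = a := h'.src_bij.1 (by
        rw [← QHom.vert_src, hb, hC'.vert_zpow_apply h', hj])
      obtain ⟨b', hb'⟩ := hC'.src_bij.2 ((T ^ i) ((T ^ j) c))
      have hbb : π.arr b' = π.arr b := h.src_bij.1 (by
        have hs : C.src (fun a => σ (π.arr a)) = C.src (fun a => σ' (π'.arr a)) := by
          simp only [hσ]
        rw [← QHom.vert_src, ← QHom.vert_src, hs, hb', hb, hC.vert_zpow_apply h, hτ]
        rfl)
      refine ⟨π'.arr b', ?_, ?_, ?_⟩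
      · rw [← QHom.vert_src, hb', hC'.vert_zpow_apply h', hC'.vert_zpow_apply h', hj]
      · rw [← hσ, hbb, hσ, hba]
      · rw [← hπ, hbb, hπ, hba])
  refine hinj _ _ ?_ ?_
  · rw [hC.vert_zpow_apply h, hτ]
    rfl
  · rw [hC'.vert_zpow_apply h', ← hρ, haut]

/-- Two alignments of a cycle agree on all arrows or on none. -/
lemma FinQuiver.IsRotation.sign_eq_or {C : FinQuiver.{u}} {σ σ' : C.A → Bool}
    {T : Equiv.Perm C.V} (hC : C.IsRotation σ T) (h' : C.IsAligned σ') :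
    (∀ a, σ a = σ' a) ∨ ∀ a, σ a = !σ' a := by
  have step : ∀ a b, C.dst σ a = C.src σ b → (σ a = σ' a ↔ σ b = σ' b) := by
    intro a b hab
    by_contra hne
    have hne' : a ≠ b := fun h => hne (by rw [h])
    have hd := hne' ∘ @h'.dst_inj a b
    have hs := hne' ∘ @h'.src_inj a b
    simp only [FinQuiver.src, FinQuiver.dst] at hab hd hs
    revert hne hab hd hs
    cases σ a <;> cases σ b <;> cases σ' a <;> cases σ' b <;> simp <;> tauto
  by_cases hall : ∀ a, σ a = σ' a
  · exact Or.inl hall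
  · push Not at hall
    obtain ⟨a₀, ha₀⟩ := hall
    right
    have key : ∀ i : ℤ, ∀ a, C.src σ a = (T ^ i) (C.src σ a₀) → σ a ≠ σ' a := by
      intro i
      induction i using Int.induction_on with
      | zero =>
        intro a ha
        rwa [hC.src_bij.1 ha]
      | succ i ih =>
        intro a ha
        obtain ⟨b, hb⟩ := hC.src_bij.2 ((T ^ (i : ℤ)) (C.src σ a₀))
        have := step b a (by
          rw [← hC.map_src, hb, ha, ← Equiv.Perm.mul_apply, ← zpow_one_add, add_comm])
        exact fun h => ih b hb (this.2 h)
      | pred i ih =>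
        intro a ha
        obtain ⟨b, hb⟩ := hC.src_bij.2 ((T ^ (-(i : ℤ))) (C.src σ a₀))
        have := step a b (by
          rw [← hC.map_src, hb, ha, ← Equiv.Perm.mul_apply, ← zpow_one_add]
          congr 2
          ring)
        exact fun h => ih b hb (this.1 h)
    intro a
    obtain ⟨i, hi⟩ := hC.sameCycle (C.src σ a₀) (C.src σ a)
    have := key i a hi.symm
    revert this
    cases σ a <;> cases σ' a <;> simp

/-- A component of the fibre product of two cyclic shapes that is not linear is the graph of an
isomorphism. -/
lemma exists_shapeIso_of_not_isLinear {G : Shape.{u₁} Q} {G' : Shape.{u₂} Q} (hG : G.IsCyclic)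
    (hG' : G'.IsCyclic) (c : (G.fibre G').P.Comp)
    (hc : ¬ ((G.fibre G').restrictComp c).IsLinear) :
    ∃ ρ : ShapeIso G G', ∀ z : (G.fibre G').P.V, (G.fibre G').P.comp z = c →
      ρ.vert z.1.1 = z.1.2 := by
  obtain ⟨σ, τ, h⟩ := hG.1.exists_rotation
  obtain ⟨σ₁, τ₁, h₁⟩ := hG'.1.exists_rotation
  let C := (G.fibre G').P.compQuiver c
  let π : QHom C G.P := compFst G G' c
  let π' : QHom C G'.P := compSnd G G' c
  have hπ : ∀ a, G.F.arr (π.arr a) = G'.F.arr (π'.arr a) := fun a => a.1.2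
  have hinj : ∀ c d, π.vert c = π.vert d → π'.vert c = π'.vert d → c = d := fun c d h1 h2 =>
    Subtype.ext (Subtype.ext (Prod.ext h1 h2))
  obtain ⟨T, hC⟩ := (h.isAligned.comap π (compFst_isStrict G G' c)).exists_rotation
    (FinQuiver.compQuiver_isConnected _ c) hc
  -- Reversing the second cycle if necessary, both run in the same direction along the component.
  obtain ⟨σ', τ', h', hσ⟩ : ∃ (σ' : G'.P.A → Bool) (τ' : Equiv.Perm G'.P.V),
      G'.P.IsRotation σ' τ' ∧ ∀ a, σ (π.arr a) = σ' (π'.arr a) := by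
    rcases hC.sign_eq_or (h₁.isAligned.comap π' (compSnd_isStrict G G' c)) with hs | hs
    · exact ⟨σ₁, τ₁, h₁, hs⟩
    · exact ⟨_, _, h₁.reverse, hs⟩
  have hC' : C.IsRotation (fun a => σ' (π'.arr a)) T := by
    simpa only [hσ] using hC
  have hfst := fst_injective_of_rotation hπ hinj h h' hC hC' hσ fun ρ => (hG'.2 ρ).1
  have hsnd := fst_injective_of_rotation (fun a => (hπ a).symm) (fun c d h1 h2 => hinj c d h2 h1)
    h' h hC' hC (fun a => (hσ a).symm) fun ρ => (hG.2 ρ).1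
  obtain ⟨x₀, hx₀⟩ := FinQuiver.exists_comp_eq _ c
  let c₀ : C.V := ⟨x₀, hx₀⟩
  have bij : Function.Bijective π.vert := ⟨fun c d => hfst c d, fun y => by
    obtain ⟨i, hi⟩ := h.sameCycle (π.vert c₀) y
    exact ⟨(T ^ i) c₀, by rw [hC.vert_zpow_apply h, hi]⟩⟩
  have bij' : Function.Bijective π'.vert := ⟨fun c d => hsnd c d, fun y => by
    obtain ⟨i, hi⟩ := h'.sameCycle (π'.vert c₀) y
    exact ⟨(T ^ i) c₀, by rw [hC'.vert_zpow_apply h', hi]⟩⟩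
  let φ : G.P.V ≃ G'.P.V := (Equiv.ofBijective _ bij).symm.trans (Equiv.ofBijective _ bij')
  have hφ : ∀ z, φ (π.vert z) = π'.vert z := fun z => by
    have : (Equiv.ofBijective _ bij).symm (π.vert z) = z :=
      (Equiv.ofBijective _ bij).symm_apply_apply z
    simp [φ, this]
  obtain ⟨ρ, hρ⟩ := exists_shapeIso h h' φ (fun x => by
      obtain ⟨z, rfl⟩ := bij.2 x
      rw [hφ, ← hC.vert_apply h, hφ, hC'.vert_apply h']) (fun a => by
      obtain ⟨z, hz⟩ := bij.2 (G.P.src σ a)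
      obtain ⟨b, hb⟩ := hC.src_bij.2 z
      have hba : π.arr b = a := h.src_bij.1 (by rw [← QHom.vert_src, hb, hz])
      refine ⟨π'.arr b, ?_, ?_, ?_⟩
      · rw [← hba, ← QHom.vert_src, ← QHom.vert_src, hφ]
        simp only [hσ]
      · rw [← hσ, hba]
      · rw [← hπ, hba])
  exact ⟨ρ, fun z hz => (hρ _).trans (hφ ⟨z, hz⟩)⟩

/-- The diagonal of a fibre product of a cyclic shape with itself is a component isomorphic to
the shape. It is the only component that is not linear. -/
lemma exists_diagonal_component {G : Shape.{u₁} Q} (hG : G.IsCyclic) :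
    ∃ (c : (G.fibre G).P.Comp) (ρ : ShapeIso G ((G.fibre G).restrictComp c)),
      (∀ a, (ρ.arr a).1.1 = (a, a)) ∧
      ∀ d : (G.fibre G).P.Comp, ¬ ((G.fibre G).restrictComp d).IsLinear ↔ d = c := by
  obtain ⟨σ, τ, h⟩ := hG.1.exists_rotation
  have hV : Nonempty G.P.V := by
    obtain ⟨n, e, -⟩ := hG.1
    exact ⟨e 0⟩
  obtain ⟨x₀⟩ := hV
  let δ : G.P.V → (G.fibre G).P.V := fun x => ⟨(x, x), rfl⟩
  let δA : G.P.A → (G.fibre G).P.A := fun a => ⟨(a, a), rfl⟩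
  let c := (G.fibre G).P.comp (δ x₀)
  have hδ : ∀ x, (G.fibre G).P.comp (δ x) = c := by
    have hstep : ∀ x, (G.fibre G).P.comp (δ (τ x)) = (G.fibre G).P.comp (δ x) := fun x => by
      obtain ⟨a, rfl⟩ := h.src_bij.2 x
      have := (G.fibre G).P.comp_t_eq_comp_h (δA a)
      rw [h.map_src]
      cases hσ : σ a <;> simp only [FinQuiver.src, FinQuiver.dst, hσ, cond_true, cond_false]
      · exact this
      · exact this.symm
    have hpow : ∀ i : ℤ, (G.fibre G).P.comp (δ ((τ ^ i) x₀)) = c := fun i => by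
      induction i using Int.induction_on with
      | zero => rfl
      | succ i ih =>
        rw [add_comm, zpow_add, Equiv.Perm.mul_apply, zpow_one, hstep, ih]
      | pred i ih =>
        rw [← ih, ← hstep, ← Equiv.Perm.mul_apply, ← zpow_one_add,
          show 1 + (-(i : ℤ) - 1) = -i by ring]
    intro x
    obtain ⟨i, rfl⟩ := h.sameCycle x₀ x
    exact hpow i
  have hdiag : ∀ z, (G.fibre G).P.comp z = c → z.1.1 = z.1.2 := by
    intro z hz
    refine FinQuiver.of_comp_eq (P := (G.fibre G).P) (S := fun z => z.1.1 = z.1.2) ?_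
      hz.symm rfl
    rintro ⟨⟨a, b⟩, hab⟩
    constructor
    · intro ht
      by_contra hh
      exact (G.strict a b (fun h => hh (by subst h; rfl)) hab).1 ht
    · intro hh
      by_contra ht
      exact (G.strict a b (fun h => ht (by subst h; rfl)) hab).2 hh
  let ρ : ShapeIso G ((G.fibre G).restrictComp c) :=
    { vert :=
        { toFun := fun x => ⟨δ x, hδ x⟩
          invFun := fun z => z.1.1.1
          left_inv := fun _ => rfl
          right_inv := fun z =>
            Subtype.ext (Subtype.ext (Prod.ext rfl (hdiag z.1 z.2))) }
      arr :=
        { toFun := fun a => ⟨δA a, hδ (G.P.t a)⟩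
          invFun := fun a => a.1.1.1
          left_inv := fun _ => rfl
          right_inv := fun a => by
            refine Subtype.ext (Subtype.ext (Prod.ext rfl ?_))
            change a.1.1.1 = a.1.1.2
            by_contra hne
            exact (G.strict _ _ hne a.1.2).1 (hdiag _ a.2) }
      vert_t := fun _ => rfl
      vert_h := fun _ => rfl
      comp_vert := fun _ => rfl
      comp_arr := fun _ => rfl }
  refine ⟨c, ρ, fun _ => rfl, fun d => ⟨fun hd => ?_, ?_⟩⟩
  · obtain ⟨ρ', hρ'⟩ := exists_shapeIso_of_not_isLinear hG hG d hd
    obtain ⟨z, rfl⟩ := FinQuiver.exists_comp_eq _ d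
    have h1 := hρ' z rfl
    rw [(hG.2 ρ').1] at h1
    have : z = δ z.1.1 := Subtype.ext (Prod.ext rfl h1.symm)
    rw [this, hδ]
  · rintro rfl hl
    have h1 := FinQuiver.IsLinear.card hl
    rw [← Nat.card_congr ρ.vert, ← Nat.card_congr ρ.arr,
      Nat.card_congr (Equiv.ofBijective _ h.src_bij)] at h1
    omega

end Cyclic

/-! ### Jordan blocks -/

section Jordan

variable {k : Type v} [Field k]

lemma jordan_apply (lam : k) (s : ℕ) (f : Fin s → k) (i : Fin s) :
    jordan lam s f i = lam * f i + if h : (i : ℕ) + 1 < s then f ⟨i + 1, h⟩ else 0 := by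
  have h1 : ∀ j : Fin s, (if i = j then lam else if (i : ℕ) + 1 = (j : ℕ) then 1 else 0) * f j =
      (if i = j then lam * f j else 0) + if (i : ℕ) + 1 = (j : ℕ) then f j else 0 := fun j => by
    by_cases hij : i = j
    · subst hij
      simp
    · by_cases h : (i : ℕ) + 1 = (j : ℕ) <;> simp [hij, h]
  simp only [jordan, Matrix.toLin'_apply, Matrix.mulVec, dotProduct, Matrix.of_apply, h1,
    Finset.sum_add_distrib]
  congr 1
  · simp
  · by_cases h : (i : ℕ) + 1 < s
    · rw [dif_pos h, Finset.sum_eq_single ⟨i + 1, h⟩]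
      · simp
      · intro j _ hj
        rw [if_neg fun h' => hj (Fin.ext h'.symm)]
      · simp
    · rw [dif_neg h]
      exact Finset.sum_eq_zero fun j _ => if_neg (by omega)

lemma jordan_eq_add (lam : k) (s : ℕ) : jordan lam s = lam • LinearMap.id + jordan 0 s := by
  ext f i
  simp [jordan_apply]

lemma jordan_zero_isNilpotent (s : ℕ) : IsNilpotent (jordan (0 : k) s) := by
  have key : ∀ (j : ℕ) (f : Fin s → k) (i : Fin s), s ≤ i + j → (jordan (0 : k) s ^ j) f i = 0 := by
    intro j
    induction j with
    | zero => intro f i hi; omega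
    | succ j ih =>
      intro f i hi
      rw [pow_succ', Module.End.mul_apply, jordan_apply, zero_mul, zero_add]
      split_ifs with h
      · exact ih f _ (by simp only; omega)
      · rfl
  exact ⟨s, LinearMap.ext fun f => funext fun i => key s f i (by omega)⟩

lemma jordan_bijective {lam : k} (h : lam ≠ 0) (s : ℕ) : Function.Bijective (jordan lam s) := by
  rw [← Module.End.isUnit_iff, jordan_eq_add]
  refine (jordan_zero_isNilpotent s).isUnit_add_left_of_commute ?_ ?_
  · have := (IsUnit.mk0 lam h).map (algebraMap k (Module.End k (Fin s → k)))
    rwa [Algebra.algebraMap_eq_smul_one] at this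
  · exact ((Commute.one_right _).smul_right lam)

/-- For `λ ≠ 0` the Jordan block `J_λ(s)` is similar to `λ J_1(s)`, by a diagonal matrix. -/
lemma exists_jordan_scaling {lam : k} (h : lam ≠ 0) (s : ℕ) :
    ∃ e : (Fin s → k) ≃ₗ[k] (Fin s → k), ∀ f, jordan lam s (e f) = e (lam • jordan 1 s f) := by
  refine ⟨LinearEquiv.piCongrRight fun i =>
    LinearEquiv.smulOfUnit (Units.mk0 (lam ^ (i : ℕ)) (pow_ne_zero _ h)), fun f => ?_⟩
  funext i
  rw [jordan_apply]
  change lam * (lam ^ (i : ℕ) * f i) +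
    (if h : (i : ℕ) + 1 < s then lam ^ ((i : ℕ) + 1) * f ⟨i + 1, h⟩ else 0) =
      lam ^ (i : ℕ) * (lam * jordan 1 s f i)
  rw [jordan_apply]
  split_ifs <;> ring

open Polynomial in
/-- In the basis `X^(l-1), …, X, 1` of `k[X]/(X^l)`, multiplication by `X` is the nilpotent Jordan
block. -/
lemma exists_quotient_X_pow_equiv (l : ℕ) :
    ∃ q : (k[X] ⧸ k[X] ∙ (X : k[X]) ^ l) ≃ₗ[k] (Fin l → k),
      ∀ p, q ((X : k[X]) • p) = jordan 0 l (q p) := by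
  let c : k[X] →ₗ[k] (Fin l → k) := LinearMap.pi fun i => Polynomial.lcoeff k (Fin.rev i)
  have hc : ∀ p i, c p i = p.coeff (Fin.rev i) := fun _ _ => rfl
  have hker : (k[X] ∙ (X : k[X]) ^ l).restrictScalars k = LinearMap.ker c := by
    ext p
    rw [Submodule.restrictScalars_mem, LinearMap.mem_ker, Submodule.mem_span_singleton]
    have : (∃ a : k[X], a • (X : k[X]) ^ l = p) ↔ (X : k[X]) ^ l ∣ p :=
      ⟨fun ⟨a, ha⟩ => ⟨a, by rw [← ha, smul_eq_mul, mul_comm]⟩,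
        fun ⟨a, ha⟩ => ⟨a, by rw [ha, smul_eq_mul, mul_comm]⟩⟩
    rw [this, X_pow_dvd_iff]
    constructor
    · intro h
      funext i
      exact h _ (Fin.rev i).2
    · intro h d hd
      have := congrFun h (Fin.rev ⟨d, hd⟩)
      rwa [hc, Fin.rev_rev] at this
  have hsurj : Function.Surjective c := fun g => by
    refine ⟨∑ j : Fin l, monomial (j : ℕ) (g (Fin.rev j)), funext fun i => ?_⟩
    rw [hc, finsetSum_coeff, Finset.sum_eq_single (Fin.rev i)]
    · rw [coeff_monomial, if_pos rfl, Fin.rev_rev]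
    · intro j _ hj
      rw [coeff_monomial, if_neg fun h => hj (Fin.ext h)]
    · simp
  let q := ((Submodule.Quotient.restrictScalarsEquiv k (k[X] ∙ (X : k[X]) ^ l)).symm.trans
    (Submodule.quotEquivOfEq _ _ hker)).trans (c.quotKerEquivOfSurjective hsurj)
  have hq : ∀ p, q (Submodule.Quotient.mk p) = c p := fun p => rfl
  refine ⟨q, fun p => ?_⟩
  obtain ⟨p, rfl⟩ := Submodule.Quotient.mk_surjective _ p
  rw [← Submodule.Quotient.mk_smul, hq, hq]
  funext i
  rw [jordan_apply, zero_mul, zero_add, hc, smul_eq_mul]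
  split_ifs with h
  · rw [hc]
    have : (Fin.rev i : ℕ) = (Fin.rev (⟨i + 1, h⟩ : Fin l) : ℕ) + 1 := by
      simp only [Fin.val_rev]
      omega
    rw [this, coeff_X_mul]
  · have : (Fin.rev i : ℕ) = 0 := by
      simp only [Fin.val_rev]
      omega
    rw [this, coeff_X_mul_zero]

open Polynomial in
/-- The Jordan normal form of a nilpotent endomorphism, from the structure theorem for modules over
`k[X]`. Blocks of size zero are allowed. -/
lemma exists_nilpotent_jordan_form {V : Type w} [AddCommGroup V] [Module k V]
    [FiniteDimensional k V] (φ : V →ₗ[k] V) (hφ : IsNilpotent φ) :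
    ∃ (d : ℕ) (l : Fin d → ℕ) (e : V ≃ₗ[k] (∀ i, Fin (l i) → k)),
      ∀ f i, e (φ f) i = jordan 0 (l i) (e f i) := by
  classical
  obtain ⟨N, hN⟩ := hφ
  have htors : Module.IsTorsion' (Module.AEval' φ) (Submonoid.powers (X : k[X])) := by
    intro x
    obtain ⟨f, rfl⟩ := (Module.AEval'.of φ).surjective x
    refine ⟨⟨X ^ N, N, rfl⟩, ?_⟩
    change (X : k[X]) ^ N • Module.AEval'.of φ f = 0
    rw [Module.AEval'.X_pow_smul_of, hN, zero_smul, map_zero]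
  obtain ⟨d, l, ⟨ε⟩⟩ := Module.torsion_by_prime_power_decomposition
    (Polynomial.irreducible_X (R := k)) htors
  choose q hq using fun i => exists_quotient_X_pow_equiv (k := k) (l i)
  let ε' := ε.trans (DirectSum.linearEquivFunOnFintype k[X] (Fin d)
    fun i => k[X] ⧸ k[X] ∙ (X : k[X]) ^ (l i))
  refine ⟨d, l, ((Module.AEval'.of φ).trans (ε'.restrictScalars k)).trans
    (LinearEquiv.piCongrRight q), fun f i => ?_⟩
  have h1 : ε' (Module.AEval'.of φ (φ f)) = (X : k[X]) • ε' (Module.AEval'.of φ f) := by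
    rw [← Module.AEval'.X_smul_of, map_smul]
  change q i (ε' (Module.AEval'.of φ (φ f)) i) = jordan 0 (l i) (q i (ε' (Module.AEval'.of φ f) i))
  rw [h1, Pi.smul_apply, hq]

/-- A finite family of blocks can be sorted by size, and the empty blocks can be dropped. -/
lemma exists_sorted_blocks (k : Type v) [Field k] {d : ℕ} (l : Fin d → ℕ) :
    ∃ (n : ℕ) (r : Fin n → Fin d), Antitone (l ∘ r) ∧ (∀ j, 0 < l (r j)) ∧
      ∃ e : (∀ i, Fin (l i) → k) ≃ₗ[k] (∀ j, Fin (l (r j)) → k), ∀ f j, e f j = f (r j) := by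
  classical
  let ε := Fintype.equivFin {i : Fin d // 0 < l i}
  let n := Fintype.card {i : Fin d // 0 < l i}
  let g : Fin n → ℕᵒᵈ := fun j => OrderDual.toDual (l (ε.symm j))
  let r' : Fin n ≃ {i : Fin d // 0 < l i} := (Tuple.sort g).trans ε.symm
  refine ⟨n, fun j => r' j, fun i j hij => Tuple.monotone_sort g hij, fun j => (r' j).2, ?_⟩
  refine ⟨LinearEquiv.ofBijective
    (LinearMap.pi fun j => LinearMap.proj (φ := fun i => Fin (l i) → k) (r' j).1) ⟨?_, ?_⟩,
    fun _ _ => rfl⟩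
  · intro f f' hff
    funext i
    by_cases hi : 0 < l i
    · have := congrFun hff (r'.symm ⟨i, hi⟩)
      simp only [LinearMap.pi_apply, LinearMap.proj_apply] at this
      rwa [Equiv.apply_symm_apply] at this
    · funext x
      exact absurd x.2 (by omega)
  · intro f
    let F := (Equiv.piCongrLeft (fun i : {i : Fin d // 0 < l i} => Fin (l i) → k) r') f
    have hF : ∀ j, F (r' j) = f j := fun j =>
      Equiv.piCongrLeft_apply_apply (fun i : {i : Fin d // 0 < l i} => Fin (l i) → k) r' f j
    refine ⟨fun i => if h : 0 < l i then F ⟨i, h⟩ else 0, funext fun j => ?_⟩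
    simp only [LinearMap.pi_apply, LinearMap.proj_apply]
    rw [dif_pos (r' j).2]
    exact hF j

/-- The block sizes of `J_λ(s) ⊗ J_μ(t)` are those of `J_1(s) ⊗ J_1(t)`, since the former is similar
to `λμ` times the latter. The endomorphism `J_1(s) ⊗ J_1(t)` is the identity plus a nilpotent. -/
lemma exists_isJordanDecomp (k : Type v) [Field k] (s t : ℕ) :
    ∃ (n : ℕ) (l : Fin n → ℕ), ∀ lam mu : k, lam ≠ 0 → mu ≠ 0 → IsJordanDecomp lam mu s t l := by
  let T : ((Fin s → k) ⊗[k] (Fin t → k)) →ₗ[k] ((Fin s → k) ⊗[k] (Fin t → k)) :=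
    TensorProduct.map (jordan 1 s) (jordan 1 t)
  let A : Module.End k ((Fin s → k) ⊗[k] (Fin t → k)) :=
    TensorProduct.map (jordan 0 s) (jordan 1 t)
  let B : Module.End k ((Fin s → k) ⊗[k] (Fin t → k)) :=
    TensorProduct.map LinearMap.id (jordan 0 t)
  have hT : T = LinearMap.id + (A + B) := by
    have h1 : jordan (1 : k) t = LinearMap.id + jordan 0 t := by
      rw [jordan_eq_add 1, one_smul]
    have h2 : jordan (1 : k) s = jordan 0 s + LinearMap.id := by
      rw [jordan_eq_add 1, one_smul, add_comm]
    simp only [T, A, B]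
    conv_lhs => rw [h2, TensorProduct.map_add_left]
    conv_lhs => enter [2]; rw [h1, TensorProduct.map_add_right, TensorProduct.map_id]
    abel
  have hA : IsNilpotent A := by
    obtain ⟨N, hN⟩ := jordan_zero_isNilpotent (k := k) s
    exact ⟨N, by rw [TensorProduct.map_pow, hN, TensorProduct.map_zero_left]⟩
  have hB : IsNilpotent B := by
    obtain ⟨N, hN⟩ := jordan_zero_isNilpotent (k := k) t
    exact ⟨N, by rw [TensorProduct.map_pow, hN, TensorProduct.map_zero_right]⟩
  have hAB : Commute A B := by
    have h1 : Commute (jordan (1 : k) t) (jordan 0 t) := by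
      rw [jordan_eq_add 1, one_smul]
      exact (Commute.one_left _).add_left (Commute.refl _)
    change A * B = B * A
    simp only [A, B, Module.End.mul_eq_comp, ← TensorProduct.map_comp]
    congr 1
  obtain ⟨d, l, e, he⟩ := exists_nilpotent_jordan_form (A + B) (hAB.isNilpotent_add hA hB)
  obtain ⟨n, r, hanti, hpos, ε, hε⟩ := exists_sorted_blocks k l
  have heT : ∀ f i, e (T f) i = jordan 1 (l i) (e f i) := fun f i => by
    rw [hT, jordan_eq_add 1, one_smul, LinearMap.add_apply, map_add, Pi.add_apply, he]
    rfl
  refine ⟨n, l ∘ r, fun lam mu hlam hmu => ⟨hanti, hpos, ?_⟩⟩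
  obtain ⟨D₁, hD₁⟩ := exists_jordan_scaling hlam s
  obtain ⟨D₂, hD₂⟩ := exists_jordan_scaling hmu t
  choose D hD using fun j : Fin n => exists_jordan_scaling (mul_ne_zero hlam hmu) (l (r j))
  let E := (((TensorProduct.congr D₁ D₂).symm.trans e).trans ε).trans
    (LinearEquiv.piCongrRight D)
  have hcomm : ∀ f, TensorProduct.map (jordan lam s) (jordan mu t) (TensorProduct.congr D₁ D₂ f) =
      TensorProduct.congr D₁ D₂ ((lam * mu) • T f) := fun f => by
    induction f using TensorProduct.induction_on with
    | zero => simp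
    | add f g hf hg => simp only [map_add, smul_add, hf, hg]
    | tmul f g =>
      simp only [T, TensorProduct.congr_tmul, TensorProduct.map_tmul, hD₁, hD₂, map_smul,
        TensorProduct.smul_tmul', TensorProduct.tmul_smul, mul_smul, smul_comm lam mu]
  refine ⟨E, LinearMap.ext fun f => ?_⟩
  obtain ⟨f, rfl⟩ := (TensorProduct.congr D₁ D₂).surjective f
  funext j
  change jordan (lam * mu) (l (r j)) (E _ j) = E (TensorProduct.map _ _ _) j
  have hE : ∀ g, E (TensorProduct.congr D₁ D₂ g) j = D j (e g (r j)) := fun g => by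
    simp only [E, LinearEquiv.trans_apply, LinearEquiv.symm_apply_apply,
      LinearEquiv.piCongrRight_apply, hε]
  rw [hcomm, hE, hE, hD, ← heT, map_smul e]
  rfl

end Jordan

/-! ### Representations of linear quivers -/

section Linear

variable {k : Type v} [Field k]

/-- A representation of a linear quiver by isomorphisms between copies of `W` is constant: an
identification with `W` at one end is transported along the arrows. -/
lemma FinQuiver.IsLinear.exists_trivialization {P : FinQuiver.{u}} (hP : P.IsLinear)
    (m : Rep.{u, v, w} k P) (hm : ∀ a, Function.Bijective (m.map (P.hom a)))
    (W : Type w₁) [AddCommGroup W] [Module k W] (hW : ∀ x, Nonempty (m.obj x ≃ₗ[k] W)) :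
    ∃ φ : ∀ x, m.obj x ≃ₗ[k] W, ∀ a f, φ _ (m.map (P.hom a) f) = φ _ f := by
  obtain ⟨n, e, f, hf⟩ := hP
  have hstep : ∀ (a : P.A) (x y : P.V), P.t a = x → P.h a = y →
      ∃ s : m.obj x ≃ₗ[k] m.obj y, ∀ φ : ∀ x, m.obj x ≃ₗ[k] W,
        (∀ g, φ y (s g) = φ x g) → ∀ g, φ _ (m.map (P.hom a) g) = φ _ g := by
    rintro a _ _ rfl rfl
    exact ⟨LinearEquiv.ofBijective _ (hm a), fun φ h => h⟩
  have hstep' : ∀ i : Fin n, ∃ s : m.obj (e i.castSucc) ≃ₗ[k] m.obj (e i.succ),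
      ∀ φ : ∀ x, m.obj x ≃ₗ[k] W, (∀ g, φ _ (s g) = φ _ g) →
        ∀ g, φ _ (m.map (P.hom (f i)) g) = φ _ g := fun i => by
    rcases hf i with ⟨h1, h2⟩ | ⟨h1, h2⟩
    · exact hstep (f i) _ _ h1 h2
    · obtain ⟨s, hs⟩ := hstep (f i) _ _ h1 h2
      refine ⟨s.symm, fun φ h => hs φ fun g => ?_⟩
      rw [← h, LinearEquiv.symm_apply_apply]
  choose s hs using hstep'
  obtain ⟨θ₀⟩ := hW (e 0)
  let θ : ∀ i, m.obj (e i) ≃ₗ[k] W :=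
    Fin.induction θ₀ fun i θ => (s i).symm.trans θ
  have hθ : ∀ i g, θ i.succ (s i g) = θ i.castSucc g := fun i g => by
    have : θ i.succ = (s i).symm.trans (θ i.castSucc) := Fin.induction_succ _ _ _
    rw [this, LinearEquiv.trans_apply, LinearEquiv.symm_apply_apply]
  let φ : ∀ x, m.obj x ≃ₗ[k] W := Equiv.piCongrLeft (fun x => m.obj x ≃ₗ[k] W) e θ
  have hφ : ∀ i, φ (e i) = θ i :=
    Equiv.piCongrLeft_apply_apply (fun x => m.obj x ≃ₗ[k] W) e θ
  refine ⟨φ, fun a g => ?_⟩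
  obtain ⟨i, rfl⟩ := f.surjective a
  exact hs i φ (fun g => by rw [hφ, hφ, hθ]) g

end Linear

/-! ### Tensor products of strings and bands -/

section Main

variable {k : Type v} [Field k] {Q : FinQuiver.{u}}

/-- A representation of a linear shape by isomorphisms between spaces of dimension `d` pushes down
to `d` copies of the string. -/
lemma pushdown_isIso_copies {F : Shape.{u₁} Q} (hF : F.IsLinear) (m : Rep.{u₁, v, w} k F.P)
    (hm : ∀ a, Function.Bijective (m.map (F.P.hom a))) (d : ℕ)
    (hW : ∀ x, Nonempty (m.obj x ≃ₗ[k] (Fin d → k))) :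
    (pushdown F.F m).IsIso (Rep.copies d (stringRep k F)) := by
  obtain ⟨φ, hφ⟩ := hF.exists_trivialization m hm _ hW
  have h : m.IsIso (Rep.directSum fun _ : Fin d => chi k F.P) :=
    Rep.isIso_of_arrows φ fun a f => (hφ a f).symm
  exact h.pushdown.trans (pushdown_directSum F _)

lemma pushdown_isIso_stringRep {F : Shape.{u₁} Q} (hF : F.IsLinear) (m : Rep.{u₁, v, w} k F.P)
    (hm : ∀ a, Function.Bijective (m.map (F.P.hom a)))
    (hW : ∀ x, Nonempty (m.obj x ≃ₗ[k] k)) :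
    (pushdown F.F m).IsIso (stringRep k F) := by
  obtain ⟨φ, hφ⟩ := hF.exists_trivialization m hm _ hW
  have h : m.IsIso (chi k F.P) := Rep.isIso_of_arrows φ fun a f => (hφ a f).symm
  exact h.pushdown

/-- The tensor product of the pull-backs of two representations to a component of the fibre
product. -/
def compTensor (F₁ : Shape.{u₁} Q) (F₂ : Shape.{u₂} Q) (m₁ : Rep.{u₁, v, w₁} k F₁.P)
    (m₂ : Rep.{u₂, v, w₂} k F₂.P) (c : (F₁.fibre F₂).P.Comp) :
    Rep.{max u₁ u₂, v, max w₁ w₂} k ((F₁.fibre F₂).restrictComp c).P :=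
  ((m₁.pullback (fibreFst F₁ F₂)).tensor (m₂.pullback (fibreSnd F₁ F₂))).pullback
    ((F₁.fibre F₂).P.inclComp c)

lemma tensor_pushdown_components (F₁ : Shape.{u₁} Q) (F₂ : Shape.{u₂} Q)
    (m₁ : Rep.{u₁, v, w₁} k F₁.P) (m₂ : Rep.{u₂, v, w₂} k F₂.P) :
    ((pushdown F₁.F m₁).tensor (pushdown F₂.F m₂)).IsIso
      (Rep.directSum fun c => pushdown ((F₁.fibre F₂).restrictComp c).F
        (compTensor F₁ F₂ m₁ m₂ c)) :=
  (tensor_pushdown F₁ F₂ m₁ m₂).trans (pushdown_components _ _)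

lemma compTensor_bijective {F₁ : Shape.{u₁} Q} {F₂ : Shape.{u₂} Q}
    {m₁ : Rep.{u₁, v, w₁} k F₁.P} {m₂ : Rep.{u₂, v, w₂} k F₂.P}
    (h₁ : ∀ a, Function.Bijective (m₁.map (F₁.P.hom a)))
    (h₂ : ∀ a, Function.Bijective (m₂.map (F₂.P.hom a))) (c : (F₁.fibre F₂).P.Comp)
    (a : ((F₁.fibre F₂).restrictComp c).P.A) :
    Function.Bijective ((compTensor F₁ F₂ m₁ m₂ c).map
      (((F₁.fibre F₂).restrictComp c).P.hom a)) :=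
  (TensorProduct.congr (LinearEquiv.ofBijective _ (h₁ a.1.1.1))
    (LinearEquiv.ofBijective _ (h₂ a.1.1.2))).bijective

/-- If all components of the fibre product are linear, the tensor product of the push-downs of
two representations by isomorphisms is a direct sum of strings. -/
lemma tensor_isIso_of_forall_isLinear {F₁ : Shape.{u₁} Q} {F₂ : Shape.{u₂} Q}
    {m₁ : Rep.{u₁, v, w₁} k F₁.P} {m₂ : Rep.{u₂, v, w₂} k F₂.P}
    (hl : ∀ c, ((F₁.fibre F₂).restrictComp c).IsLinear)
    {N : LinComp F₁ F₂ → Rep.{u, v, w} k Q}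
    (hN : ∀ c : LinComp F₁ F₂, (pushdown c.shape.F (compTensor F₁ F₂ m₁ m₂ c.1)).IsIso (N c)) :
    ((pushdown F₁.F m₁).tensor (pushdown F₂.F m₂)).IsIso (Rep.directSum N) :=
  (tensor_pushdown_components F₁ F₂ m₁ m₂).trans
    ((Rep.directSum_reindex (Equiv.subtypeUnivEquiv hl : LinComp F₁ F₂ ≃ _) _).trans
      (Rep.IsIso.directSum hN))

/-- If exactly one component of the fibre product is not linear, it contributes an additional
summand. -/
lemma tensor_isIso_of_unique {F₁ : Shape.{u₁} Q} {F₂ : Shape.{u₂} Q}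
    {m₁ : Rep.{u₁, v, w₁} k F₁.P} {m₂ : Rep.{u₂, v, w₂} k F₂.P} (c₀ : (F₁.fibre F₂).P.Comp)
    (hc₀ : ∀ c, ¬ ((F₁.fibre F₂).restrictComp c).IsLinear ↔ c = c₀)
    {N : LinComp F₁ F₂ → Rep.{u, v, w} k Q} {M : Rep.{u, v, max u₁ u₂ w} k Q}
    (hM : (pushdown ((F₁.fibre F₂).restrictComp c₀).F (compTensor F₁ F₂ m₁ m₂ c₀)).IsIso M)
    (hN : ∀ c : LinComp F₁ F₂, (pushdown c.shape.F (compTensor F₁ F₂ m₁ m₂ c.1)).IsIso (N c)) :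
    ((pushdown F₁.F m₁).tensor (pushdown F₂.F m₂)).IsIso (M.prod (Rep.directSum N)) := by
  let _ : Unique {c // ¬ ((F₁.fibre F₂).restrictComp c).IsLinear} :=
    { default := ⟨c₀, (hc₀ c₀).2 rfl⟩
      uniq := fun c => Subtype.ext ((hc₀ c.1).1 c.2) }
  refine (tensor_pushdown_components F₁ F₂ m₁ m₂).trans
    ((Rep.directSum_split (fun c => ((F₁.fibre F₂).restrictComp c).IsLinear) _).trans ?_)
  exact Rep.IsIso.prod ((Rep.directSum_unique _).trans hM) (Rep.IsIso.directSum hN)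

lemma chi_bijective (P : FinQuiver.{u}) (a : P.A) :
    Function.Bijective ((chi k P).map (P.hom a)) := Function.bijective_id

lemma bandModule_bijective {P : FinQuiver.{u}} {lam : k} (hlam : lam ≠ 0) (s : ℕ) (γ a : P.A) :
    Function.Bijective ((bandModule lam s γ).map (P.hom a)) := by
  classical
  have key : ∀ φ : (Fin s → k) →ₗ[k] (Fin s → k),
      φ = (if a = γ then jordan lam s else LinearMap.id) → Function.Bijective φ := by
    rintro φ rfl
    split_ifs
    · exact jordan_bijective hlam s
    · exact Function.bijective_id
  exact key _ rfl

lemma stringRep_isModule {I : PathIdeal k Q} {F : Shape.{u₁} Q} (hF : F.Compatible I) :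
    (stringRep k F).IsModule I :=
  (hF.kills_pushdown _).isModule
    (pushdown_finiteDimensional _ _ fun _ => inferInstanceAs (FiniteDimensional k k))

lemma bandRep_isModule {I : PathIdeal k Q} {G : Shape.{u₁} Q} (hG : G.Compatible I) (lam : k)
    (s : ℕ) (γ : G.P.A) : (bandRep G lam s γ).IsModule I :=
  (hG.kills_pushdown _).isModule
    (pushdown_finiteDimensional _ _ fun _ => inferInstanceAs (FiniteDimensional k (Fin s → k)))

lemma tensor_pushdown_isModule {I : PathIdeal k Q} {F₁ : Shape.{u₁} Q} {F₂ : Shape.{u₂} Q}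
    (hF : F₁.Compatible I) {m₁ : Rep.{u₁, v, w₁} k F₁.P} {m₂ : Rep.{u₂, v, w₂} k F₂.P}
    (h₁ : (pushdown F₁.F m₁).IsModule I) (h₂ : (pushdown F₂.F m₂).IsModule I) :
    ((pushdown F₁.F m₁).tensor (pushdown F₂.F m₂)).IsModule I := by
  refine ((hF.kills_pushdown _).tensor _).isModule fun x => ?_
  have := h₁.1 x
  have := h₂.1 x
  exact inferInstanceAs (FiniteDimensional k
    ((pushdown F₁.F m₁).obj x ⊗[k] (pushdown F₂.F m₂).obj x))

/-- On the diagonal component the tensor product of two bands is, as a representation of the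
cycle, the Jordan block `J_λ(s) ⊗ J_μ(t)` at `γ` and the identity elsewhere. -/
lemma pushdown_diagonal_isIso {G : Shape.{u₁} Q} {c : (G.fibre G).P.Comp}
    (ρ : ShapeIso G ((G.fibre G).restrictComp c)) (hρ : ∀ a, (ρ.arr a).1.1 = (a, a))
    {lam mu : k} {s t n : ℕ} {l : Fin n → ℕ} (hl : IsJordanDecomp lam mu s t l) (γ : G.P.A) :
    (pushdown ((G.fibre G).restrictComp c).F
      (compTensor G G (bandModule lam s γ) (bandModule mu t γ) c)).IsIso
      (Rep.directSum fun i : Fin n => bandRep G (lam * mu) (l i) γ) := by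
  classical
  obtain ⟨-, -, e, he⟩ := hl
  refine Rep.IsIso.trans (Rep.IsIso.symm ?_)
    (pushdown_directSum G fun i : Fin n => bandModule (lam * mu) (l i) γ)
  refine pushdown_isIso_of_shapeIso ρ _ _ (fun _ => e.symm) fun a f => ?_
  have h1 : (ρ.arr a).1.1.1 = a := congrArg Prod.fst (hρ a)
  have h2 : (ρ.arr a).1.1.2 = a := congrArg Prod.snd (hρ a)
  change TensorProduct.map (if (ρ.arr a).1.1.1 = γ then jordan lam s else LinearMap.id)
    (if (ρ.arr a).1.1.2 = γ then jordan mu t else LinearMap.id) (e.symm f) =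
    e.symm (fun i => (if a = γ then jordan (lam * mu) (l i) else LinearMap.id) (f i))
  rw [h1, h2, LinearEquiv.eq_symm_apply]
  split_ifs
  · have := LinearMap.congr_fun he (e.symm f)
    refine this.symm.trans ?_
    exact congrArg (LinearMap.pi fun i => jordan (lam * mu) (l i) ∘ₗ LinearMap.proj i)
      (e.apply_symm_apply f)
  · rw [TensorProduct.map_id]
    exact e.apply_symm_apply f

end Main

end StringCG

open StringCG
theorem theorem4p5 {k : Type v} [Field k] [IsAlgClosed k] (Q : FinQuiver.{u})
    (I : PathIdeal k Q) (hI : I.IsSemiMonomial) :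
    -- the strings and the bands are modules over `kQ/I`
    (∀ F : Shape.{w} Q, F.IsLinear → F.Compatible I → (stringRep k F).IsModule I) ∧
    (∀ G : Shape.{w} Q, G.IsCyclic → G.Compatible I →
      ∀ lam : k, lam ≠ 0 → ∀ s : ℕ, 0 < s → ∀ γ : G.P.A, (bandRep G lam s γ).IsModule I) ∧
    -- string ⊗ string
    (∀ (F : Shape.{w} Q) (F' : Shape.{w} Q), F.IsLinear → F'.IsLinear →
      F.Compatible I → F'.Compatible I →
      IsoMod I ((stringRep k F).tensor (stringRep k F'))
        (Rep.directSum fun H : LinComp F F' => stringRep k H.shape)) ∧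
    -- string ⊗ band
    (∀ (F : Shape.{w} Q) (G : Shape.{w} Q), F.IsLinear → G.IsCyclic →
      F.Compatible I → G.Compatible I →
      ∀ lam : k, lam ≠ 0 → ∀ s : ℕ, 0 < s → ∀ γ : G.P.A,
      IsoMod I ((stringRep k F).tensor (bandRep G lam s γ))
        (Rep.directSum fun H : LinComp F G => Rep.copies s (stringRep k H.shape))) ∧
    -- band ⊗ band, non-isomorphic shapes
    (∀ (G : Shape.{w} Q) (G' : Shape.{w} Q), G.IsCyclic → G'.IsCyclic →
      G.Compatible I → G'.Compatible I → IsEmpty (ShapeIso G G') →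
      ∀ lam mu : k, lam ≠ 0 → mu ≠ 0 → ∀ s t : ℕ, 0 < s → 0 < t →
      ∀ (γ : G.P.A) (γ' : G'.P.A),
      IsoMod I ((bandRep G lam s γ).tensor (bandRep G' mu t γ'))
        (Rep.directSum fun H : LinComp G G' => Rep.copies (s * t) (stringRep k H.shape))) ∧
    -- the block sizes `l` exist and depend only on `s` and `t` (and `k`)
    (∀ s t : ℕ, 0 < s → 0 < t → ∃ (n : ℕ) (l : Fin n → ℕ),
      ∀ lam mu : k, lam ≠ 0 → mu ≠ 0 → IsJordanDecomp lam mu s t l) ∧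
    -- band ⊗ band, equal shapes
    (∀ G : Shape.{w} Q, G.IsCyclic → G.Compatible I →
      ∀ lam mu : k, lam ≠ 0 → mu ≠ 0 → ∀ s t : ℕ, 0 < s → 0 < t → ∀ γ : G.P.A,
      ∀ (n : ℕ) (l : Fin n → ℕ), IsJordanDecomp lam mu s t l →
      IsoMod I ((bandRep G lam s γ).tensor (bandRep G mu t γ))
        ((Rep.directSum fun i : Fin n => bandRep G (lam * mu) (l i) γ).prod
          (Rep.directSum fun H : LinComp G G => Rep.copies (s * t) (stringRep k H.shape)))) := by
  have hk : Nonempty (k ⊗[k] k ≃ₗ[k] k) := ⟨TensorProduct.lid k k⟩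
  have hks : ∀ s : ℕ, Nonempty (k ⊗[k] (Fin s → k) ≃ₗ[k] (Fin s → k)) := fun s =>
    ⟨TensorProduct.lid k _⟩
  have hst : ∀ s t : ℕ, Nonempty ((Fin s → k) ⊗[k] (Fin t → k) ≃ₗ[k] (Fin (s * t) → k)) :=
    fun s t => ⟨LinearEquiv.ofFinrankEq _ _ (by simp)⟩
  refine ⟨fun F _ hF => stringRep_isModule hF, fun G _ hG lam _ s _ γ => bandRep_isModule hG _ _ _,
    ?_, ?_, ?_, fun s t _ _ => exists_isJordanDecomp k s t, ?_⟩
  · intro F F' hF _ hFI hFI'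
    refine Rep.isoMod_of_isIso (tensor_pushdown_isModule hFI (stringRep_isModule hFI)
      (stringRep_isModule hFI')) (tensor_isIso_of_forall_isLinear
        (restrictComp_fibre_isLinear hF F') fun c => pushdown_isIso_stringRep c.2 _
          (compTensor_bijective (chi_bijective _) (chi_bijective _) c.1) fun _ => hk)
  · intro F G hF _ hFI hGI lam hlam s _ γ
    refine Rep.isoMod_of_isIso (tensor_pushdown_isModule hFI (stringRep_isModule hFI)
      (bandRep_isModule hGI lam s γ)) (tensor_isIso_of_forall_isLinear
        (restrictComp_fibre_isLinear hF G) fun c => pushdown_isIso_copies c.2 _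
          (compTensor_bijective (chi_bijective _) (bandModule_bijective hlam s γ) c.1) s
          fun _ => hks s)
  · intro G G' hG hG' hGI hGI' hne lam mu hlam hmu s t _ _ γ γ'
    have hl : ∀ c, ((G.fibre G').restrictComp c).IsLinear := fun c => by
      by_contra hc
      obtain ⟨ρ, -⟩ := exists_shapeIso_of_not_isLinear hG hG' c hc
      exact hne.false ρ
    exact Rep.isoMod_of_isIso (tensor_pushdown_isModule hGI (bandRep_isModule hGI lam s γ)
      (bandRep_isModule hGI' mu t γ')) (tensor_isIso_of_forall_isLinear hl fun c =>
        pushdown_isIso_copies c.2 _ (compTensor_bijective (bandModule_bijective hlam s γ)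
          (bandModule_bijective hmu t γ') c.1) (s * t) fun _ => hst s t)
  · intro G hG hGI lam mu hlam hmu s t _ _ γ n l hl
    obtain ⟨c₀, ρ, hρ, hc₀⟩ := exists_diagonal_component hG
    exact Rep.isoMod_of_isIso (tensor_pushdown_isModule hGI (bandRep_isModule hGI lam s γ)
      (bandRep_isModule hGI mu t γ)) (tensor_isIso_of_unique c₀ hc₀
        (pushdown_diagonal_isIso ρ hρ hl γ) fun c => pushdown_isIso_copies c.2 _
          (compTensor_bijective (bandModule_bijective hlam s γ)
            (bandModule_bijective hmu t γ) c.1) (s * t) fun _ => hst s t)
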